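/- Let $A$ and $B$ be finite-dimensional Hilbert spaces with $\dim A\ge 1$, and write $|B|=\dim B$. Let $S(\rho)=-\mathrm{tr}(\rho\log\rho)$ denote the von Neumann entropy. For a quantum channel (completely positive trace-preserving linear map) $\Phi$ define $$\mathcal C^{(1)}(\Phi)=\max_{\{p_i,\rho_i\}}\Big[S\Big(\sum_i p_i\Phi(\rho_i)\Big)-\sum_i p_iS(\Phi(\rho_i))\Big],\quad \mathcal C^{(n)}(\Phi)=\tfrac1n\mathcal C^{(1)}(\Phi^{\otimes n}),\quad \mathcal C(\Phi)=\lim_{n\to\infty}\mathcal C^{(n)}(\Phi),$$ the maximum being over finite ensembles of input states, and for $P\ge 0$ $$\mathcal C^{(1)}_P(\Phi)=\max_{\{p_i,\rho_i\}:\ \sum_ip_iS(\rho_i)\le P}\Big[\sum_ip_iS(\rho_i)+S\Big(\Phi\Big(\sum_ip_i\rho_i\Big)\Big)-\sum_ip_iS\big((\Phi\otimes\mathcal I)(\phi_{\rho_i})\big)\Big],\quad \mathcal C^{(n)}_P(\Phi)=\tfrac1n\mathcal C^{(1)}_{nP}(\Phi^{\otimes n}),$$ where $\phi_\rho$ denotes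 (the density matrix of) a purification of $\rho$. Let $\mathcal N_0$ and $\mathcal N_1$ be quantum channels from $A$ to $B$, where $\mathcal N_0$ is classical, i.e. $\mathcal N_0(\rho)=\sum_{x,y}W(y|x)\langle u_x|\rho|u_x\rangle\,|v_y\rangle\langle v_y|$ for some orthonormal bases $\{|u_x\rangle\}$ of $A$ and $\{|v_y\rangle\}$ of $B$ and some stochastic matrix $W$. Suppose that (0.1) $\mathcal C(\mathcal N_0)=\log|B|-\min_\rho S(\mathcal N_0(\rho))$, the minimum being over all states $\rho$ of $A$; (1.2) for all integers $n\ge1$ and all real $P\ge0$, $$\mathcal C^{(n)}_P(\mathcal N_1)=\log|B|-\min_{\rho:\ S(\rho)\le nP}\tfrac1n\big\{S\big((\mathcal N_1^{\otimes n}\otimes\mathcal I)(\phi_\rho)\big)-S(\rho)\big\},$$ the minimum being over states $\rho$ of $A^{\otimes n}$. Let $M$ be a qubit with orthonormal basis $|0\rangle,|1\rangle$ and let $\mathcal N$ be the conditional channel from $M\otimes A$ to $B$ given by $$\mathcal N(\rho)=\mathcal N_0\big(\langle0|\rho|0\rangle^M\big)+\mathcal N_1\big(\langle1|\rho|1\rangle^M\big).$$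 Then the limits defining $\mathcal C(\mathcal N)$, $\mathcal C(\mathcal N_0)$ and $\mathcal C(\mathcal N_1)$ exist, and $$\mathcal C^{(1)}(\mathcal N)=\max\{\mathcal C(\mathcal N_0),\mathcal C^{(1)}(\mathcal N_1)\},\qquad \mathcal C(\mathcal N)=\max\{\mathcal C(\mathcal N_0),\mathcal C(\mathcal N_1)\}.$$ -/

import Mathlib

open Filter Topology
open scoped ComplexOrder

namespace QuantumShannon

noncomputable section

/-- A density matrix on the Hilbert space with orthonormal basis indexed by `A`. -/
def IsState {A : Type*} [Fintype A] (ρ : Matrix A A ℂ) : Prop :=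
  ρ.PosSemidef ∧ ρ.trace = 1

/-- The von Neumann entropy `S(ρ) = -tr (ρ log ρ)` (natural logarithm, `0 log 0 = 0`). -/
def vonNeumannEntropy {A : Type*} [Fintype A] [DecidableEq A] (ρ : Matrix A A ℂ) : ℝ :=
  -(ρ * cfc Real.log ρ).trace.re

/-- The map `Φ ⊗ id_E`: it applies `Φ` to each of the blocks `X_{e e'}` of `X`. -/
def tensorId {A B : Type*} (Φ : Matrix A A ℂ →ₗ[ℂ] Matrix B B ℂ) (E : Type*) :
    Matrix (A × E) (A × E) ℂ →ₗ[ℂ] Matrix (B × E) (B × E) ℂ where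
  toFun X := Matrix.of fun i j => Φ (X.submatrix (fun a => (a, i.2)) (fun a => (a, j.2))) i.1 j.1
  map_add' X Y := by
    ext i j
    simp [Matrix.submatrix_add]
  map_smul' c X := by
    ext i j
    simp [Matrix.submatrix_smul]

/-- A quantum channel: a completely positive trace preserving linear map. -/
structure IsChannel {A B : Type*} [Fintype A] [Fintype B]
    (Φ : Matrix A A ℂ →ₗ[ℂ] Matrix B B ℂ) : Prop where
  completely_positive : ∀ (k : ℕ) (X : Matrix (A × Fin k) (A × Fin k) ℂ),
    X.PosSemidef → (tensorId Φ (Fin k) X).PosSemidef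
  trace_preserving : ∀ X : Matrix A A ℂ, (Φ X).trace = X.trace

/-- A classical channel: for an orthonormal basis `u` of the input space (the columns of `U`), an
orthonormal basis `v` of the output space (the columns of `V`) and a stochastic matrix `W`,
`Φ(ρ) = ∑ x y, W(y|x) ⟨u_x|ρ|u_x⟩ |v_y⟩⟨v_y|`. -/
def IsClassical {A B : Type*} [Fintype A] [DecidableEq A] [Fintype B] [DecidableEq B]
    (Φ : Matrix A A ℂ →ₗ[ℂ] Matrix B B ℂ) : Prop :=
  ∃ U ∈ Matrix.unitaryGroup A ℂ, ∃ V ∈ Matrix.unitaryGroup B ℂ, ∃ W : A → B → ℝ,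
    (∀ x y, 0 ≤ W x y) ∧ (∀ x, ∑ y, W x y = 1) ∧
    ∀ ρ : Matrix A A ℂ,
      Φ ρ = V * Matrix.diagonal (fun y => ∑ x, (W x y : ℂ) * (U.conjTranspose * ρ * U) x x) *
        V.conjTranspose

/-- The `n`-fold tensor power `Φ^{⊗ n}`, the space `A^{⊗ n}` having the product basis indexed by
`Fin n → A`. -/
def tensorPower {A B : Type*} [Fintype A] [DecidableEq A]
    (Φ : Matrix A A ℂ →ₗ[ℂ] Matrix B B ℂ) (n : ℕ) :
    Matrix (Fin n → A) (Fin n → A) ℂ →ₗ[ℂ] Matrix (Fin n → B) (Fin n → B) ℂ where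
  toFun X := Matrix.of fun b b' =>
    ∑ a, ∑ a', X a a' * ∏ k, Φ (Matrix.single (a k) (a' k) 1) (b k) (b' k)
  map_add' X Y := by
    ext b b'
    simp [add_mul, Finset.sum_add_distrib]
  map_smul' c X := by
    ext b b'
    simp [mul_assoc, Finset.mul_sum]

/-- The conditional channel with control qubit `M` (basis `Fin 2`):
`N(ρ) = N₀(⟨0|ρ|0⟩) + N₁(⟨1|ρ|1⟩)`. -/
def conditionalChannel {A B : Type*} (N₀ N₁ : Matrix A A ℂ →ₗ[ℂ] Matrix B B ℂ) :
    Matrix (Fin 2 × A) (Fin 2 × A) ℂ →ₗ[ℂ] Matrix B B ℂ where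
  toFun X := N₀ (X.submatrix (Prod.mk 0) (Prod.mk 0)) + N₁ (X.submatrix (Prod.mk 1) (Prod.mk 1))
  map_add' X Y := by
    simp only [Matrix.submatrix_add, Pi.add_apply, map_add]
    abel
  map_smul' c X := by
    simp [Matrix.submatrix_smul]

/-- A finite ensemble `{p_i, ρ_i}` of states. -/
structure Ensemble (A : Type*) [Fintype A] where
  size : ℕ
  p : Fin size → ℝ
  ρ : Fin size → Matrix A A ℂ
  p_nonneg : ∀ i, 0 ≤ p i
  p_sum : ∑ i, p i = 1
  isState : ∀ i, IsState (ρ i)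

section Capacity

variable {A B : Type*} [Fintype A] [DecidableEq A] [Fintype B] [DecidableEq B]

/-- The Holevo information `S(∑ p_i Φ(ρ_i)) - ∑ p_i S(Φ(ρ_i))`. -/
def holevoInfo (Φ : Matrix A A ℂ →ₗ[ℂ] Matrix B B ℂ) (𝓔 : Ensemble A) : ℝ :=
  vonNeumannEntropy (∑ i, (𝓔.p i : ℂ) • Φ (𝓔.ρ i)) -
    ∑ i, 𝓔.p i * vonNeumannEntropy (Φ (𝓔.ρ i))

/-- The one-shot classical capacity (Holevo capacity) `C⁽¹⁾(Φ)`. -/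
def oneShotCapacity (Φ : Matrix A A ℂ →ₗ[ℂ] Matrix B B ℂ) : ℝ :=
  sSup (Set.range (holevoInfo Φ))

/-- The `n`-shot classical capacity `C⁽ⁿ⁾(Φ) = C⁽¹⁾(Φ^{⊗ n}) / n`. -/
def nShotCapacity (Φ : Matrix A A ℂ →ₗ[ℂ] Matrix B B ℂ) (n : ℕ) : ℝ :=
  oneShotCapacity (tensorPower Φ n) / n

/-- The regularized classical capacity `C(Φ) = lim C⁽ⁿ⁾(Φ)`. -/
def classicalCapacity (Φ : Matrix A A ℂ →ₗ[ℂ] Matrix B B ℂ) : ℝ :=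
  limUnder atTop (nShotCapacity Φ)

/-- `|ψ⟩ ∈ A ⊗ E` is a purification of `ρ`, i.e. `tr_E |ψ⟩⟨ψ| = ρ`. The reference system is
`E = A`, which is large enough to purify every state of `A`. -/
def IsPurification (ψ : A × A → ℂ) (ρ : Matrix A A ℂ) : Prop :=
  ∀ a a', ∑ e, ψ (a, e) * star (ψ (a', e)) = ρ a a'

/-- `S((Φ ⊗ id)(|ψ⟩⟨ψ|))`. -/
def jointOutputEntropy (Φ : Matrix A A ℂ →ₗ[ℂ] Matrix B B ℂ) (ψ : A × A → ℂ) : ℝ :=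
  vonNeumannEntropy (tensorId Φ A (Matrix.vecMulVec ψ (star ψ)))

/-- The one-shot classical capacity with entanglement assistance `P`, `C⁽¹⁾_P(Φ)`: the supremum,
over the ensembles with `∑ p_i S(ρ_i) ≤ P`, of
`∑ p_i S(ρ_i) + S(Φ(∑ p_i ρ_i)) - ∑ p_i S((Φ ⊗ id)(φ_i))` with `φ_i` a purification of `ρ_i`. -/
def assistedOneShotCapacity (Φ : Matrix A A ℂ →ₗ[ℂ] Matrix B B ℂ) (P : ℝ) : ℝ :=
  sSup {x | ∃ (𝓔 : Ensemble A) (ψ : Fin 𝓔.size → A × A → ℂ),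
    (∀ i, IsPurification (ψ i) (𝓔.ρ i)) ∧
    ∑ i, 𝓔.p i * vonNeumannEntropy (𝓔.ρ i) ≤ P ∧
    x = ∑ i, 𝓔.p i * vonNeumannEntropy (𝓔.ρ i) +
      vonNeumannEntropy (Φ (∑ i, (𝓔.p i : ℂ) • 𝓔.ρ i)) -
      ∑ i, 𝓔.p i * jointOutputEntropy Φ (ψ i)}

/-- `C⁽ⁿ⁾_P(Φ) = C⁽¹⁾_{nP}(Φ^{⊗ n}) / n`. -/
def assistedNShotCapacity (Φ : Matrix A A ℂ →ₗ[ℂ] Matrix B B ℂ) (n : ℕ) (P : ℝ) : ℝ :=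
  assistedOneShotCapacity (tensorPower Φ n) (n * P) / n

/-- The minimum output entropy `min_ρ S(Φ(ρ))`. -/
def minOutputEntropy (Φ : Matrix A A ℂ →ₗ[ℂ] Matrix B B ℂ) : ℝ :=
  sInf {x | ∃ ρ : Matrix A A ℂ, IsState ρ ∧ x = vonNeumannEntropy (Φ ρ)}

/-- `min_{S(ρ) ≤ nP} (1/n) {S((Φ^{⊗ n} ⊗ id)(φ_ρ)) - S(ρ)}`, where `ρ` runs over the states of
`A^{⊗ n}` and `φ_ρ` is a purification of `ρ`. -/
def minEntropyGap (Φ : Matrix A A ℂ →ₗ[ℂ] Matrix B B ℂ) (n : ℕ) (P : ℝ) : ℝ :=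
  sInf {x | ∃ (ρ : Matrix (Fin n → A) (Fin n → A) ℂ) (ψ : (Fin n → A) × (Fin n → A) → ℂ),
    IsState ρ ∧ IsPurification ψ ρ ∧ vonNeumannEntropy ρ ≤ n * P ∧
    x = 1 / (n : ℝ) * (jointOutputEntropy (tensorPower Φ n) ψ - vonNeumannEntropy ρ)}

end Capacity

end

end QuantumShannon

open QuantumShannon

/-! The upper bound comes from a lower bound on the output entropy of `n` uses of the conditional
channel. Every use dephases its control, so an input splits into blocks labelled by control strings
`m`, and the output is the sum of the images of these blocks under the products of the channels `N
(m k)`. By concavity of the entropy it is enough to bound the output entropy of each such product.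
Let `k` of its factors be `N₀` and `l = n - k` be `N₁`. As `N₀` is classical, it measures its inputs
in a fixed basis; given the outcome, the output is a product of `k` prepared states with an output
of `N₁^{⊗ l}`. Hence its entropy is at least `k` times the minimum output entropy of `N₀` plus the
minimum for `N₁^{⊗ l}` (`le_vonNeumannEntropy_prodMap_mixed`). No additivity of minimum output
entropy for `N₁` is needed.

Hypothesis `h01` makes the first minimum `log|B| - C(N₀)`. Hypothesis `h12` at `P = 0`, where all
inputs that matter are pure, bounds the second below by `l log|B| - C⁽¹⁾(N₁^{⊗ l})`
(`mul_log_sub_oneShotCapacity_le`). If `C(N₀) ≤ K` and `C⁽¹⁾(N₁^{⊗ l}) ≤ l K` for all `l ≤ n`, the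
output entropy is therefore at least `n (log|B| - K)`, and the Holevo information is at most `n K`.
The choice `n = 1`, `K = max (C(N₀)) (C⁽¹⁾(N₁))` gives the one-shot formula; arbitrary `n` with `K =
max (C(N₀)) (C(N₁))` gives the regularized one.

The lower bounds come from fixing the control. In the one-shot formula this yields `C⁽¹⁾(N₀)`, which
dominates `C(N₀)` because classical channels have additive capacity. The limits exist by Fekete's
lemma, from superadditivity over product ensembles and the bound `log|B|`. -/

namespace QuantumShannon
open Matrix Real

set_option linter.unusedSectionVars false

/-! ### Spectral form, concavity and additivity of the entropy -/

section Entropy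

variable {A B ι : Type*} [Fintype A] [DecidableEq A] [Fintype B] [DecidableEq B]
  [Fintype ι]

/-- The matrix `U d U†` with the given eigenvector matrix and real eigenvalues. -/
noncomputable def ofEigen (U : Matrix A A ℂ) (d : A → ℝ) : Matrix A A ℂ :=
  U * diagonal (fun i => (d i : ℂ)) * Uᴴ

theorem ofEigen_apply (U : Matrix A A ℂ) (d : A → ℝ) (a b : A) :
    ofEigen U d a b = ∑ i, (d i : ℂ) * (U a i * star (U b i)) := by
  rw [ofEigen, Matrix.mul_apply]
  refine Finset.sum_congr rfl fun i _ => ?_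
  rw [mul_diagonal, conjTranspose_apply]
  ring

theorem isHermitian_ofEigen (U : Matrix A A ℂ) (d : A → ℝ) : (ofEigen U d).IsHermitian := by
  ext a b
  simp only [conjTranspose_apply, ofEigen_apply, star_sum]
  refine Finset.sum_congr rfl fun i _ => ?_
  rw [star_mul', star_mul', star_star, RCLike.star_def, Complex.conj_ofReal, mul_comm (U a i)]

theorem posSemidef_ofEigen (U : Matrix A A ℂ) {d : A → ℝ} (hd : ∀ i, 0 ≤ d i) :
    (ofEigen U d).PosSemidef := by
  refine PosSemidef.mul_mul_conjTranspose_same (PosSemidef.diagonal fun i => ?_) U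
  exact Complex.zero_le_real.2 (hd i)

theorem trace_ofEigen {U : Matrix A A ℂ} (hU : U ∈ unitaryGroup A ℂ) (d : A → ℝ) :
    (ofEigen U d).trace = ((∑ i, d i : ℝ) : ℂ) := by
  have h : Uᴴ * U = 1 := (mem_unitaryGroup_iff').1 hU
  rw [ofEigen, trace_mul_comm, ← Matrix.mul_assoc, h, Matrix.one_mul, trace_diagonal]
  push_cast; rfl

theorem isState_ofEigen {U : Matrix A A ℂ} (hU : U ∈ unitaryGroup A ℂ) {d : A → ℝ}
    (hd : ∀ i, 0 ≤ d i) (h1 : ∑ i, d i = 1) : IsState (ofEigen U d) :=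
  ⟨posSemidef_ofEigen U hd, by rw [trace_ofEigen hU, h1, Complex.ofReal_one]⟩

theorem exists_ofEigen {ρ : Matrix A A ℂ} (hρ : ρ.IsHermitian) :
    ∃ U ∈ unitaryGroup A ℂ, ρ = ofEigen U hρ.eigenvalues := by
  refine ⟨hρ.eigenvectorUnitary, hρ.eigenvectorUnitary.2, ?_⟩
  conv_lhs => rw [hρ.spectral_theorem]
  rfl

theorem IsState.exists_ofEigen {ρ : Matrix A A ℂ} (hρ : IsState ρ) :
    ∃ U ∈ unitaryGroup A ℂ, ∃ d : A → ℝ, (∀ i, 0 ≤ d i) ∧ ∑ i, d i = 1 ∧ ρ = ofEigen U d := by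
  obtain ⟨U, hU, h⟩ := QuantumShannon.exists_ofEigen hρ.1.1
  refine ⟨U, hU, _, hρ.1.eigenvalues_nonneg, ?_, h⟩
  have := hρ.2
  rw [h, trace_ofEigen hU] at this
  exact_mod_cast this

theorem vonNeumannEntropy_eq_sum_eigenvalues {ρ : Matrix A A ℂ} (hρ : ρ.IsHermitian) :
    vonNeumannEntropy ρ = ∑ i, negMulLog (hρ.eigenvalues i) := by
  obtain ⟨U, hU, h⟩ : ∃ U ∈ unitaryGroup A ℂ, ρ = ofEigen U hρ.eigenvalues ∧
      cfc Real.log ρ = ofEigen U (Real.log ∘ hρ.eigenvalues) := by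
    refine ⟨hρ.eigenvectorUnitary, hρ.eigenvectorUnitary.2, ?_, ?_⟩
    · conv_lhs => rw [hρ.spectral_theorem]
      rfl
    · rw [hρ.cfc_eq]; rfl
  have hU1 : Uᴴ * U = 1 := (mem_unitaryGroup_iff').1 hU
  have : ρ * cfc Real.log ρ =
      ofEigen U (fun i => hρ.eigenvalues i * Real.log (hρ.eigenvalues i)) := by
    rw [h.2]
    nth_rw 1 [h.1]
    simp only [ofEigen, Function.comp]
    rw [show ∀ a b c d e : Matrix A A ℂ, a * b * c * (d * e * c) = a * (b * ((c * d) * e)) * c from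
      fun a b c d e => by simp only [Matrix.mul_assoc], hU1, Matrix.one_mul, diagonal_mul_diagonal]
    push_cast; rfl
  rw [vonNeumannEntropy, this, trace_ofEigen hU, Complex.ofReal_re, ← Finset.sum_neg_distrib]
  simp [negMulLog]

/-- The characteristic polynomial forgets the eigenbasis and the order of the eigenvalues, so
entropies can be compared without matching spectra index by index. -/
theorem vonNeumannEntropy_eq_sum_roots {ρ : Matrix A A ℂ} (hρ : ρ.IsHermitian) :
    vonNeumannEntropy ρ = (ρ.charpoly.roots.map fun z => negMulLog z.re).sum := by
  rw [vonNeumannEntropy_eq_sum_eigenvalues hρ, hρ.roots_charpoly_eq_eigenvalues, Multiset.map_map]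
  rfl

theorem vonNeumannEntropy_ofEigen {U : Matrix A A ℂ} (hU : U ∈ unitaryGroup A ℂ) (d : A → ℝ) :
    vonNeumannEntropy (ofEigen U d) = ∑ i, negMulLog (d i) := by
  have hU1 : Uᴴ * U = 1 := (mem_unitaryGroup_iff').1 hU
  have hc : (ofEigen U d).charpoly = ∏ i, (Polynomial.X - Polynomial.C ((d i : ℝ) : ℂ)) := by
    rw [ofEigen, charpoly_mul_comm, ← Matrix.mul_assoc, hU1, Matrix.one_mul, charpoly_diagonal]
  rw [vonNeumannEntropy_eq_sum_roots (isHermitian_ofEigen U d), hc, Polynomial.roots_prod _ _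
    (Finset.prod_ne_zero_iff.2 fun i _ => Polynomial.X_sub_C_ne_zero _)]
  simp only [Polynomial.roots_X_sub_C, Multiset.bind_singleton, Multiset.map_map]
  rfl

theorem vonNeumannEntropy_submatrix {ρ : Matrix A A ℂ} (hρ : ρ.IsHermitian) (e : B ≃ A) :
    vonNeumannEntropy (ρ.submatrix e e) = vonNeumannEntropy ρ := by
  rw [vonNeumannEntropy_eq_sum_roots hρ, vonNeumannEntropy_eq_sum_roots (hρ.submatrix e)]
  congr 2
  have := charpoly_reindex e.symm ρ
  simpa using congrArg Polynomial.roots this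

theorem IsState.submatrix {ρ : Matrix A A ℂ} (hρ : IsState ρ) (e : B ≃ A) :
    IsState (ρ.submatrix e e) := by
  refine ⟨hρ.1.submatrix e, ?_⟩
  rw [← hρ.2]
  exact Equiv.sum_comp e fun a => ρ a a

theorem le_one_of_sum_eq_one {d : A → ℝ} (hd : ∀ i, 0 ≤ d i) (h1 : ∑ i, d i = 1) (i : A) :
    d i ≤ 1 := h1 ▸ Finset.single_le_sum (fun i _ => hd i) (Finset.mem_univ i)

/-- Jensen's inequality for `negMulLog` with uniform weights. -/
theorem sum_negMulLog_le_log_card [Nonempty A] {d : A → ℝ} (hd : ∀ i, 0 ≤ d i)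
    (h1 : ∑ i, d i = 1) : ∑ i, negMulLog (d i) ≤ Real.log (Fintype.card A) := by
  have hc : (0 : ℝ) < Fintype.card A := by exact_mod_cast Fintype.card_pos
  have := concaveOn_negMulLog.le_map_sum (t := Finset.univ) (w := fun _ : A => (1 : ℝ) / Fintype.card A)
    (p := d) (fun _ _ => by positivity) (by simp) (fun i _ => hd i)
  simp only [smul_eq_mul, ← Finset.mul_sum, h1] at this
  rw [negMulLog, mul_one, one_div, Real.log_inv] at this
  have h2 := mul_le_mul_of_nonneg_left this hc.le
  field_simp at h2
  linarith

theorem IsState.nonempty {ρ : Matrix A A ℂ} (hρ : IsState ρ) : Nonempty A := by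
  by_contra h
  rw [not_nonempty_iff] at h
  have := hρ.2
  simp [Matrix.trace] at this

theorem IsState.vonNeumannEntropy_nonneg {ρ : Matrix A A ℂ} (hρ : IsState ρ) :
    0 ≤ vonNeumannEntropy ρ := by
  obtain ⟨U, hU, d, hd, h1, rfl⟩ := hρ.exists_ofEigen
  rw [vonNeumannEntropy_ofEigen hU]
  exact Finset.sum_nonneg fun i _ => negMulLog_nonneg (hd i) (le_one_of_sum_eq_one hd h1 i)

theorem IsState.vonNeumannEntropy_le {ρ : Matrix A A ℂ} (hρ : IsState ρ) :
    vonNeumannEntropy ρ ≤ Real.log (Fintype.card A) := by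
  have := hρ.nonempty
  obtain ⟨U, hU, d, hd, h1, rfl⟩ := hρ.exists_ofEigen
  rw [vonNeumannEntropy_ofEigen hU]
  exact sum_negMulLog_le_log_card hd h1

theorem sum_normSq_row {U : Matrix A A ℂ} (hU : U ∈ unitaryGroup A ℂ) (i : A) :
    ∑ j, Complex.normSq (U i j) = 1 := by
  have h : U * Uᴴ = 1 := (mem_unitaryGroup_iff).1 hU
  have := congrFun (congrFun h i) i
  simp only [Matrix.mul_apply, conjTranspose_apply, RCLike.star_def, Complex.mul_conj, one_apply_eq] at this
  exact_mod_cast this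

theorem sum_normSq_col {U : Matrix A A ℂ} (hU : U ∈ unitaryGroup A ℂ) (j : A) :
    ∑ i, Complex.normSq (U i j) = 1 := by
  have h : Uᴴ * U = 1 := (mem_unitaryGroup_iff').1 hU
  have := congrFun (congrFun h j) j
  simp only [Matrix.mul_apply, conjTranspose_apply, RCLike.star_def, mul_comm _ (U _ _),
    Complex.mul_conj, one_apply_eq] at this
  exact_mod_cast this

theorem mul_mem_unitaryGroup' {U V : Matrix A A ℂ} (hU : U ∈ unitaryGroup A ℂ)
    (hV : V ∈ unitaryGroup A ℂ) : Vᴴ * U ∈ unitaryGroup A ℂ :=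
  mul_mem (Unitary.star_mem hV) hU

/-- The diagonal of a positive matrix in any orthonormal basis has at least the entropy of its
spectrum. -/
theorem vonNeumannEntropy_le_sum_diag {ρ : Matrix A A ℂ} (hρ : ρ.PosSemidef) {V : Matrix A A ℂ}
    (hV : V ∈ unitaryGroup A ℂ) :
    vonNeumannEntropy ρ ≤ ∑ j, negMulLog ((Vᴴ * ρ * V) j j).re := by
  obtain ⟨U, hU, h⟩ := exists_ofEigen hρ.1
  set d := hρ.1.eigenvalues with hd
  have hd0 : ∀ i, 0 ≤ d i := hρ.eigenvalues_nonneg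
  have hT := mul_mem_unitaryGroup' hU hV
  set T := Vᴴ * U with hTdef
  have hVρ : Vᴴ * ρ * V = ofEigen T d := by
    rw [h, ofEigen, ofEigen, hTdef, conjTranspose_mul, conjTranspose_conjTranspose]
    simp only [Matrix.mul_assoc]
  -- The weights `|T j i|²` are doubly stochastic: column sums turn the entropy into a double sum,
  -- row sums allow Jensen in each `j`.
  have hdiag : ∀ j, ((Vᴴ * ρ * V) j j).re = ∑ i, Complex.normSq (T j i) • d i := by
    intro j
    rw [hVρ, ofEigen_apply, Complex.re_sum]
    refine Finset.sum_congr rfl fun i _ => ?_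
    rw [RCLike.star_def, Complex.mul_conj, ← Complex.ofReal_mul, Complex.ofReal_re, smul_eq_mul,
      mul_comm]
  calc vonNeumannEntropy ρ = ∑ i, negMulLog (d i) := by
        rw [h, vonNeumannEntropy_ofEigen hU]
    _ = ∑ j, ∑ i, Complex.normSq (T j i) * negMulLog (d i) := by
        rw [Finset.sum_comm]
        simp only [← Finset.sum_mul, sum_normSq_col hT, one_mul]
    _ ≤ _ := by
        refine Finset.sum_le_sum fun j _ => ?_
        rw [hdiag]
        exact concaveOn_negMulLog.le_map_sum (fun i _ => Complex.normSq_nonneg _)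
          (sum_normSq_row hT j) fun i _ => hd0 i

/-- Concavity of the von Neumann entropy. -/
theorem sum_mul_vonNeumannEntropy_le {p : ι → ℝ} (hp : ∀ i, 0 ≤ p i) (hp1 : ∑ i, p i = 1)
    {ρ : ι → Matrix A A ℂ} (hρ : ∀ i, (ρ i).PosSemidef) :
    ∑ i, p i * vonNeumannEntropy (ρ i) ≤ vonNeumannEntropy (∑ i, (p i : ℂ) • ρ i) := by
  have hS : (∑ i, (p i : ℂ) • ρ i).PosSemidef :=
    posSemidef_sum _ fun i _ => (hρ i).smul (Complex.zero_le_real.2 (hp i))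
  set σ := ∑ i, (p i : ℂ) • ρ i with hσ
  obtain ⟨V, hV, h⟩ := exists_ofEigen hS.1
  have hV1 : Vᴴ * V = 1 := (mem_unitaryGroup_iff').1 hV
  -- In an eigenbasis of the mixture, the diagonals of the `ρ i` average to its spectrum. Passing to
  -- these diagonals only raises the entropies, and scalar concavity does the rest.
  have hdiag : ∀ j, ∑ i, p i • ((Vᴴ * ρ i * V) j j).re = hS.1.eigenvalues j := by
    intro j
    have h1 : Vᴴ * σ * V = diagonal (fun i => (hS.1.eigenvalues i : ℂ)) := by
      nth_rw 1 [h]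
      rw [ofEigen, show ∀ a b c : Matrix A A ℂ, a * (b * c * a) * b = (a * b) * (c * (a * b)) from
        fun a b c => by simp only [Matrix.mul_assoc], hV1, Matrix.one_mul, Matrix.mul_one]
    have h2 := congrArg Complex.re (congrFun (congrFun h1 j) j)
    rw [diagonal_apply_eq, Complex.ofReal_re] at h2
    rw [← h2, hσ, Matrix.mul_sum, Matrix.sum_mul, Matrix.sum_apply, Complex.re_sum]
    refine Finset.sum_congr rfl fun i _ => ?_
    rw [Matrix.mul_smul, Matrix.smul_mul, smul_eq_mul]
    exact (Complex.re_ofReal_mul _ _).symm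
  calc ∑ i, p i * vonNeumannEntropy (ρ i)
      ≤ ∑ i, p i * ∑ j, negMulLog ((Vᴴ * ρ i * V) j j).re :=
        Finset.sum_le_sum fun i _ => mul_le_mul_of_nonneg_left
          (vonNeumannEntropy_le_sum_diag (hρ i) hV) (hp i)
    _ = ∑ j, ∑ i, p i • negMulLog ((Vᴴ * ρ i * V) j j).re := by
        simp only [Finset.mul_sum, smul_eq_mul]
        exact Finset.sum_comm
    _ ≤ ∑ j, negMulLog (hS.1.eigenvalues j) := by
        refine Finset.sum_le_sum fun j _ => ?_
        rw [← hdiag]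
        refine concaveOn_negMulLog.le_map_sum (fun i _ => hp i) hp1 fun i _ => ?_
        exact (Complex.nonneg_iff.1 ((hρ i).conjTranspose_mul_mul_same V).diag_nonneg).1
    _ = vonNeumannEntropy σ := (vonNeumannEntropy_eq_sum_eigenvalues hS.1).symm

theorem isState_sum {p : ι → ℝ} (hp : ∀ i, 0 ≤ p i) (hp1 : ∑ i, p i = 1)
    {ρ : ι → Matrix A A ℂ} (hρ : ∀ i, IsState (ρ i)) : IsState (∑ i, (p i : ℂ) • ρ i) := by
  refine ⟨posSemidef_sum _ fun i _ => (hρ i).1.smul (Complex.zero_le_real.2 (hp i)), ?_⟩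
  simp only [trace_sum, trace_smul, (hρ _).2, smul_eq_mul, mul_one]
  exact_mod_cast hp1

theorem PosSemidef.trace_eq_ofReal {X : Matrix A A ℂ} (hX : X.PosSemidef) :
    X.trace = (X.trace.re : ℂ) ∧ 0 ≤ X.trace.re := by
  have := Complex.nonneg_iff.1 hX.trace_nonneg
  exact ⟨Complex.ext rfl (by simp [← this.2]), this.1⟩

theorem exists_state_smul [Nonempty A] {X : Matrix A A ℂ} (hX : X.PosSemidef) :
    ∃ ρ, IsState ρ ∧ X = (X.trace.re : ℂ) • ρ := by
  -- Trace zero forces `X = 0`, and then any state serves; blocks of zero weight need no separate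
  -- treatment later.
  by_cases h : X.trace = 0
  · refine ⟨ofEigen 1 (fun _ => 1 / Fintype.card A),
      isState_ofEigen (one_mem _) (fun _ => by positivity) (by simp), ?_⟩
    rw [h]
    simpa using hX.trace_eq_zero_iff.1 h
  · have h1 := PosSemidef.trace_eq_ofReal hX
    refine ⟨(X.trace.re : ℂ)⁻¹ • X, ⟨hX.smul ?_, ?_⟩, ?_⟩
    · rw [← Complex.ofReal_inv]
      exact Complex.zero_le_real.2 (inv_nonneg.2 h1.2)
    · rw [trace_smul, smul_eq_mul, ← h1.1, inv_mul_cancel₀ h]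
    · rw [smul_smul, ← h1.1, mul_inv_cancel₀ h, one_smul]

/-- `Φ` maps states to states. -/
def PreservesStates (Φ : Matrix A A ℂ →ₗ[ℂ] Matrix B B ℂ) : Prop :=
  ∀ ρ, IsState ρ → IsState (Φ ρ)

/-- Concavity for unnormalized inputs, whose traces act as the weights. This suits the blocks of a
state and the branches of a measurement. -/
theorem sum_trace_mul_le_vonNeumannEntropy [Nonempty A] {X : ι → Matrix A A ℂ}
    (hX : ∀ i, (X i).PosSemidef) (hX1 : ∑ i, (X i).trace = 1)
    {Φ : ι → Matrix A A ℂ →ₗ[ℂ] Matrix B B ℂ} (hΦ : ∀ i, PreservesStates (Φ i))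
    {s : ι → ℝ} (hs : ∀ i ρ, IsState ρ → s i ≤ vonNeumannEntropy (Φ i ρ)) :
    ∑ i, (X i).trace.re * s i ≤ vonNeumannEntropy (∑ i, Φ i (X i)) := by
  choose ρ hρ h using fun i => exists_state_smul (hX i)
  have h0 : ∀ i, 0 ≤ (X i).trace.re := fun i => (PosSemidef.trace_eq_ofReal (hX i)).2
  have h1 : ∑ i, (X i).trace.re = 1 := by
    rw [← Complex.re_sum, hX1, Complex.one_re]
  calc _ ≤ ∑ i, (X i).trace.re * vonNeumannEntropy (Φ i (ρ i)) :=
        Finset.sum_le_sum fun i _ => mul_le_mul_of_nonneg_left (hs i _ (hρ i)) (h0 i)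
    _ ≤ vonNeumannEntropy (∑ i, ((X i).trace.re : ℂ) • Φ i (ρ i)) :=
        sum_mul_vonNeumannEntropy_le h0 h1 fun i => (hΦ i _ (hρ i)).1
    _ = _ := by
        congr 1
        refine Finset.sum_congr rfl fun i _ => ?_
        rw [← map_smul, ← h i]

theorem le_vonNeumannEntropy_sum [Nonempty A] {X : ι → Matrix A A ℂ}
    (hX : ∀ i, (X i).PosSemidef) (hX1 : ∑ i, (X i).trace = 1)
    {Φ : ι → Matrix A A ℂ →ₗ[ℂ] Matrix B B ℂ} (hΦ : ∀ i, PreservesStates (Φ i))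
    {s : ℝ} (hs : ∀ i ρ, IsState ρ → s ≤ vonNeumannEntropy (Φ i ρ)) :
    s ≤ vonNeumannEntropy (∑ i, Φ i (X i)) := by
  refine le_trans (le_of_eq ?_) (sum_trace_mul_le_vonNeumannEntropy hX hX1 hΦ hs)
  rw [← Finset.sum_mul, ← Complex.re_sum, hX1, Complex.one_re, one_mul]

theorem conjTranspose_kronecker_apply (U : Matrix A A ℂ) (V : Matrix B B ℂ) :
    (kroneckerMap (· * ·) U V)ᴴ = kroneckerMap (· * ·) Uᴴ Vᴴ := by
  ext i j; simp

theorem kronecker_ofEigen (U : Matrix A A ℂ) (V : Matrix B B ℂ) (d : A → ℝ) (e : B → ℝ) :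
    kroneckerMap (· * ·) (ofEigen U d) (ofEigen V e) =
      ofEigen (kroneckerMap (· * ·) U V) (fun i => d i.1 * e i.2) := by
  ext i j
  simp only [kroneckerMap_apply, ofEigen_apply, Fintype.sum_prod_type, Finset.sum_mul_sum]
  refine Finset.sum_congr rfl fun a _ => Finset.sum_congr rfl fun b _ => ?_
  push_cast
  rw [star_mul']
  ring

theorem kronecker_mem_unitaryGroup {U : Matrix A A ℂ} {V : Matrix B B ℂ}
    (hU : U ∈ unitaryGroup A ℂ) (hV : V ∈ unitaryGroup B ℂ) :
    kroneckerMap (· * ·) U V ∈ unitaryGroup (A × B) ℂ := by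
  rw [mem_unitaryGroup_iff] at *
  rw [star_eq_conjTranspose, conjTranspose_kronecker_apply, ← mul_kronecker_mul]
  rw [star_eq_conjTranspose] at hU hV
  rw [hU, hV]
  exact one_kronecker_one

theorem sum_negMulLog_mul {d : A → ℝ} {e : B → ℝ} (hd : ∑ i, d i = 1) (he : ∑ i, e i = 1) :
    ∑ i : A × B, negMulLog (d i.1 * e i.2) = ∑ i, negMulLog (d i) + ∑ i, negMulLog (e i) := by
  simp only [negMulLog_mul, Finset.sum_add_distrib, Fintype.sum_prod_type]
  simp only [← Finset.mul_sum, ← Finset.sum_mul, hd, he, one_mul]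

/-- Additivity of the entropy on product states. -/
theorem vonNeumannEntropy_kronecker {ρ : Matrix A A ℂ} {σ : Matrix B B ℂ} (hρ : IsState ρ)
    (hσ : IsState σ) : vonNeumannEntropy (kroneckerMap (· * ·) ρ σ) =
      vonNeumannEntropy ρ + vonNeumannEntropy σ := by
  obtain ⟨U, hU, d, -, h1, rfl⟩ := hρ.exists_ofEigen
  obtain ⟨V, hV, e, -, h2, rfl⟩ := hσ.exists_ofEigen
  rw [kronecker_ofEigen, vonNeumannEntropy_ofEigen (kronecker_mem_unitaryGroup hU hV),
    vonNeumannEntropy_ofEigen hU, vonNeumannEntropy_ofEigen hV, sum_negMulLog_mul h1 h2]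

theorem IsState.kronecker {ρ : Matrix A A ℂ} {σ : Matrix B B ℂ} (hρ : IsState ρ)
    (hσ : IsState σ) : IsState (kroneckerMap (· * ·) ρ σ) := by
  refine ⟨hρ.1.kronecker hσ.1, ?_⟩
  rw [trace_kronecker, hρ.2, hσ.2, one_mul]

end Entropy

/-! ### Tensor products of families of matrices; Shannon subadditivity -/

section ProdMatrix

variable {A B C ι : Type*} [Fintype A] [DecidableEq A] [Fintype B] [DecidableEq B]
  [Fintype C] [Fintype ι] [DecidableEq ι]

/-- The tensor product of a family of matrices. -/
def prodMatrix (M : ι → Matrix A B ℂ) : Matrix (ι → A) (ι → B) ℂ :=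
  Matrix.of fun a b => ∏ k, M k (a k) (b k)

theorem prodMatrix_apply (M : ι → Matrix A B ℂ) (a : ι → A) (b : ι → B) :
    prodMatrix M a b = ∏ k, M k (a k) (b k) := rfl

theorem prod_sum_eq {R : Type*} [CommSemiring R] (f : ι → A → R) :
    ∏ k, ∑ a, f k a = ∑ a : ι → A, ∏ k, f k (a k) := by
  rw [Finset.prod_univ_sum, Fintype.piFinset_univ]

theorem prodMatrix_mul (M : ι → Matrix A B ℂ) (N : ι → Matrix B C ℂ) :
    prodMatrix M * prodMatrix N = prodMatrix fun k => M k * N k := by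
  ext a c
  simp only [Matrix.mul_apply, prodMatrix_apply, prod_sum_eq, Finset.prod_mul_distrib]

theorem prodMatrix_conjTranspose (M : ι → Matrix A B ℂ) :
    (prodMatrix M)ᴴ = prodMatrix fun k => (M k)ᴴ := by
  ext a b
  simp only [conjTranspose_apply, prodMatrix_apply, star_prod]

theorem prodMatrix_one : prodMatrix (fun _ : ι => (1 : Matrix A A ℂ)) = 1 := by
  ext a b
  simp only [prodMatrix_apply, one_apply, Finset.prod_ite_zero, Finset.prod_const_one,
    Finset.mem_univ, true_imp_iff, funext_iff]

theorem prodMatrix_mem_unitaryGroup {U : ι → Matrix A A ℂ} (hU : ∀ k, U k ∈ unitaryGroup A ℂ) :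
    prodMatrix U ∈ unitaryGroup (ι → A) ℂ := by
  rw [mem_unitaryGroup_iff, star_eq_conjTranspose, prodMatrix_conjTranspose, prodMatrix_mul,
    ← prodMatrix_one]
  congr 1
  funext k
  exact mem_unitaryGroup_iff.1 (hU k)

theorem prodMatrix_ofEigen (U : ι → Matrix A A ℂ) (d : ι → A → ℝ) :
    prodMatrix (fun k => ofEigen (U k) (d k)) =
      ofEigen (prodMatrix U) fun a => ∏ k, d k (a k) := by
  ext a b
  simp only [prodMatrix_apply, ofEigen_apply, prod_sum_eq, star_prod, Finset.prod_mul_distrib]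
  push_cast
  rfl

theorem isState_prodMatrix {ρ : ι → Matrix A A ℂ} (h : ∀ k, IsState (ρ k)) :
    IsState (prodMatrix ρ) := by
  choose U hU d hd h1 hρ using fun k => (h k).exists_ofEigen
  obtain rfl : ρ = fun k => ofEigen (U k) (d k) := funext hρ
  rw [prodMatrix_ofEigen]
  refine isState_ofEigen (prodMatrix_mem_unitaryGroup hU)
    (fun a => Finset.prod_nonneg fun k _ => hd k _) ?_
  rw [← prod_sum_eq]
  simp [h1]

/-- The expectation of a function of one coordinate under a product distribution. -/
theorem sum_prod_mul_apply {d : ι → A → ℝ} (h1 : ∀ k, ∑ a, d k a = 1) (k : ι) (f : A → ℝ) :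
    ∑ a : ι → A, (∏ j, d j (a j)) * f (a k) = ∑ a, d k a * f a := by
  -- Absorbing `f` into the `k`-th factor lets the sum factorize; the other factors sum to one.
  have h : ∀ a : ι → A, (∏ j, d j (a j)) * f (a k) =
      ∏ j, (if j = k then d j (a j) * f (a j) else d j (a j)) := by
    intro a
    rw [← Finset.mul_prod_erase _ _ (Finset.mem_univ k),
      ← Finset.mul_prod_erase (a := k) _ (fun j => if j = k then _ else _) (Finset.mem_univ k),
      if_pos rfl, mul_right_comm]
    congr 1
    exact Finset.prod_congr rfl fun j hj => (if_neg (Finset.ne_of_mem_erase hj)).symm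
  simp only [h]
  rw [← prod_sum_eq (fun j x => if j = k then d j x * f x else d j x),
    ← Finset.mul_prod_erase _ _ (Finset.mem_univ k)]
  simp only [if_true]
  rw [Finset.prod_eq_one, mul_one]
  intro j hj
  simp only [if_neg (Finset.ne_of_mem_erase hj), h1]

theorem negMulLog_prod (x : ι → ℝ) :
    negMulLog (∏ k, x k) = ∑ k, (∏ j, x j) * -Real.log (x k) := by
  by_cases h : ∏ k, x k = 0
  · simp [h]
  · rw [negMulLog, Real.log_prod fun i hi => (Finset.prod_ne_zero_iff.1 h) i hi,
      Finset.mul_sum]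
    exact Finset.sum_congr rfl fun k _ => by ring

theorem sum_negMulLog_prod {d : ι → A → ℝ} (h1 : ∀ k, ∑ a, d k a = 1) :
    ∑ a : ι → A, negMulLog (∏ k, d k (a k)) = ∑ k, ∑ a, negMulLog (d k a) := by
  simp only [negMulLog_prod]
  rw [Finset.sum_comm]
  refine Finset.sum_congr rfl fun k _ => ?_
  rw [sum_prod_mul_apply h1 k fun x => -Real.log (d k x)]
  exact Finset.sum_congr rfl fun a _ => by rw [negMulLog]; ring

theorem vonNeumannEntropy_prodMatrix {ρ : ι → Matrix A A ℂ} (h : ∀ k, IsState (ρ k)) :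
    vonNeumannEntropy (prodMatrix ρ) = ∑ k, vonNeumannEntropy (ρ k) := by
  choose U hU d hd h1 hρ using fun k => (h k).exists_ofEigen
  obtain rfl : ρ = fun k => ofEigen (U k) (d k) := funext hρ
  rw [prodMatrix_ofEigen, vonNeumannEntropy_ofEigen (prodMatrix_mem_unitaryGroup hU),
    sum_negMulLog_prod h1]
  simp only [vonNeumannEntropy_ofEigen (hU _)]

/-- Subadditivity of the Shannon entropy: `Q k` is the law of the `k`-th coordinate under `P`. -/
theorem sum_negMulLog_le_sum_marginals {P : (ι → A) → ℝ} (hP : ∀ a, 0 ≤ P a) (hP1 : ∑ a, P a = 1)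
    {Q : ι → A → ℝ} (hQ : ∀ k a, 0 ≤ Q k a)
    (hQP : ∀ k (f : A → ℝ), ∑ a, P a * f (a k) = ∑ x, Q k x * f x) :
    ∑ a, negMulLog (P a) ≤ ∑ k, ∑ x, negMulLog (Q k x) := by
  have hQ1 : ∀ k, ∑ x, Q k x = 1 := fun k => by
    have := hQP k fun _ => 1
    simp only [mul_one] at this
    rw [← this, hP1]
  -- Testing the marginal on the indicator of `a k` shows that the logarithms below are taken at
  -- positive numbers wherever `P a` is positive.
  have hpos : ∀ a k, 0 < P a → 0 < Q k (a k) := by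
    intro a k ha
    have h := hQP k fun x => if x = a k then 1 else 0
    simp only [mul_ite, mul_one, mul_zero, Finset.sum_ite_eq', Finset.mem_univ, if_true] at h
    rw [← h]
    refine lt_of_lt_of_le ha ?_
    refine le_trans (le_of_eq ?_)
      (Finset.single_le_sum (f := fun b => if b k = a k then P b else 0)
        (fun b _ => ?_) (Finset.mem_univ a))
    · simp
    · split_ifs
      · exact hP b
      · exact le_rfl
  -- Gibbs' inequality: `log t ≤ t - 1` at `t = (∏ k, Q k (a k)) / P a`. The correction terms sum to
  -- `1 - 1 = 0`.
  have key : ∀ a, negMulLog (P a) ≤ ∑ k, P a * -Real.log (Q k (a k)) + (∏ k, Q k (a k) - P a) := by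
    intro a
    rcases (hP a).eq_or_lt with h | h
    · rw [← h]
      simpa using Finset.prod_nonneg fun k _ => hQ k (a k)
    · have hq : ∀ k, 0 < Q k (a k) := fun k => hpos a k h
      have hq' : 0 < ∏ k, Q k (a k) := Finset.prod_pos fun k _ => hq k
      have hl := Real.log_le_sub_one_of_pos (div_pos hq' h)
      rw [Real.log_div hq'.ne' h.ne', Real.log_prod fun k _ => (hq k).ne'] at hl
      have := mul_le_mul_of_nonneg_left hl h.le
      rw [mul_sub, mul_sub, mul_div_cancel₀ _ h.ne'] at this
      rw [negMulLog, ← Finset.mul_sum, Finset.sum_neg_distrib]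
      linarith
  calc ∑ a, negMulLog (P a)
      ≤ ∑ a, (∑ k, P a * -Real.log (Q k (a k)) + (∏ k, Q k (a k) - P a)) :=
        Finset.sum_le_sum fun a _ => key a
    _ = ∑ k, ∑ x, negMulLog (Q k x) := by
        rw [Finset.sum_add_distrib, Finset.sum_sub_distrib, hP1, ← prod_sum_eq, Finset.sum_comm]
        simp only [hQ1, Finset.prod_const_one, sub_self, add_zero]
        refine Finset.sum_congr rfl fun k _ => ?_
        rw [hQP k fun x => -Real.log (Q k x)]
        exact Finset.sum_congr rfl fun x _ => by rw [negMulLog]; ring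

end ProdMatrix

/-! ### Tensor products of channels -/

section ProdMap

variable {A B ι : Type*} [Fintype A] [DecidableEq A] [Fintype B] [DecidableEq B]
  [Fintype ι] [DecidableEq ι]

/-- The tensor product `⨂ k, Φ k` of a family of linear maps. -/
def prodMap (Φ : ι → Matrix A A ℂ →ₗ[ℂ] Matrix B B ℂ) :
    Matrix (ι → A) (ι → A) ℂ →ₗ[ℂ] Matrix (ι → B) (ι → B) ℂ where
  toFun X := Matrix.of fun b b' =>
    ∑ a, ∑ a', X a a' * ∏ k, Φ k (Matrix.single (a k) (a' k) 1) (b k) (b' k)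
  map_add' X Y := by
    ext b b'
    simp [add_mul, Finset.sum_add_distrib]
  map_smul' c X := by
    ext b b'
    simp [mul_assoc, Finset.mul_sum]

theorem prodMap_apply (Φ : ι → Matrix A A ℂ →ₗ[ℂ] Matrix B B ℂ) (X : Matrix (ι → A) (ι → A) ℂ)
    (b b' : ι → B) : prodMap Φ X b b' =
      ∑ a, ∑ a', X a a' * ∏ k, Φ k (Matrix.single (a k) (a' k) 1) (b k) (b' k) := rfl

theorem tensorPower_eq_prodMap (Φ : Matrix A A ℂ →ₗ[ℂ] Matrix B B ℂ) (n : ℕ) :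
    tensorPower Φ n = prodMap fun _ => Φ := rfl

theorem map_apply_eq_sum_single (Φ : Matrix A A ℂ →ₗ[ℂ] Matrix B B ℂ) (X : Matrix A A ℂ)
    (b b' : B) : Φ X b b' = ∑ a, ∑ a', X a a' * Φ (Matrix.single a a' 1) b b' := by
  conv_lhs => rw [matrix_eq_sum_single X]
  simp only [map_sum, Matrix.sum_apply]
  refine Finset.sum_congr rfl fun a _ => Finset.sum_congr rfl fun a' _ => ?_
  rw [show Matrix.single a a' (X a a') = X a a' • Matrix.single a a' (1 : ℂ) by simp, map_smul]
  rfl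

theorem prodMap_prodMatrix (Φ : ι → Matrix A A ℂ →ₗ[ℂ] Matrix B B ℂ) (X : ι → Matrix A A ℂ) :
    prodMap Φ (prodMatrix X) = prodMatrix fun k => Φ k (X k) := by
  ext b b'
  simp only [prodMap_apply, prodMatrix_apply]
  simp only [map_apply_eq_sum_single (Φ _) (X _)]
  rw [prod_sum_eq]
  refine Finset.sum_congr rfl fun a _ => ?_
  rw [prod_sum_eq]
  simp only [Finset.prod_mul_distrib]

/-- A Kraus representation of `Φ`, from the positivity of its Choi matrix. -/
theorem IsChannel.exists_kraus {Φ : Matrix A A ℂ →ₗ[ℂ] Matrix B B ℂ} (hΦ : IsChannel Φ) :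
    ∃ K : B × Fin (Fintype.card A) → Matrix B A ℂ, ∀ a a' b b',
      Φ (Matrix.single a a' 1) b b' = ∑ j, K j b a * star (K j b' a') := by
  let e := Fintype.equivFin A
  -- The unnormalized maximally entangled vector: the blocks of its projector are the matrix units,
  -- so its image is the Choi matrix.
  let v : A × Fin (Fintype.card A) → ℂ := fun x => if e x.1 = x.2 then 1 else 0
  have h := hΦ.completely_positive _ (vecMulVec v (star v)) (posSemidef_vecMulVec_self_star v)
  obtain ⟨U, -, hU⟩ := exists_ofEigen h.1
  have hd := h.eigenvalues_nonneg
  set d := h.1.eigenvalues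
  -- The Kraus operators are the eigenvectors of the Choi matrix, scaled by the roots of the
  -- eigenvalues.
  refine ⟨fun j => Matrix.of fun b a => (√(d j) : ℂ) * U (b, e a) j, fun a a' b b' => ?_⟩
  have h1 := congrFun (congrFun hU (b, e a)) (b', e a')
  have h2 : (vecMulVec v (star v)).submatrix (fun x => (x, e a)) (fun x => (x, e a')) =
      Matrix.single a a' 1 := by
    ext x y
    simp only [submatrix_apply, vecMulVec_apply, v, Pi.star_apply, single_apply,
      EmbeddingLike.apply_eq_iff_eq, eq_comm (a := a), eq_comm (a := a')]
    by_cases hx : x = a <;> by_cases hy : y = a' <;> simp [hx, hy]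
  rw [← h2]
  refine h1.trans ?_
  rw [ofEigen_apply]
  refine Finset.sum_congr rfl fun j _ => ?_
  change _ = ((√(d j) : ℂ) * U (b, e a) j) * star ((√(d j) : ℂ) * U (b', e a') j)
  rw [star_mul', RCLike.star_def, Complex.conj_ofReal,
    mul_mul_mul_comm, ← Complex.ofReal_mul, Real.mul_self_sqrt (hd j)]

/-- Products of Kraus operators of the factors are Kraus operators of the tensor product. -/
theorem posSemidef_prodMap {Φ : ι → Matrix A A ℂ →ₗ[ℂ] Matrix B B ℂ} (hΦ : ∀ k, IsChannel (Φ k))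
    {X : Matrix (ι → A) (ι → A) ℂ} (hX : X.PosSemidef) : (prodMap Φ X).PosSemidef := by
  choose K hK using fun k => (hΦ k).exists_kraus
  have h : prodMap Φ X = ∑ j : ι → B × Fin (Fintype.card A),
      prodMatrix (fun k => K k (j k)) * X * (prodMatrix fun k => K k (j k))ᴴ := by
    ext b b'
    simp only [prodMap_apply, hK, prod_sum_eq, Matrix.sum_apply, Matrix.mul_apply,
      conjTranspose_apply, prodMatrix_apply, Finset.mul_sum, Finset.sum_mul,
      Finset.prod_mul_distrib, star_prod]
    rw [Finset.sum_comm, Finset.sum_comm (s := Finset.univ (α := ι → B × _))]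
    refine Finset.sum_congr rfl fun a' _ => ?_
    rw [Finset.sum_comm]
    refine Finset.sum_congr rfl fun j _ => ?_
    refine Finset.sum_congr rfl fun a _ => ?_
    ring
  rw [h]
  exact posSemidef_sum _ fun j _ => hX.mul_mul_conjTranspose_same _

theorem trace_prodMap {Φ : ι → Matrix A A ℂ →ₗ[ℂ] Matrix B B ℂ} (hΦ : ∀ k, IsChannel (Φ k))
    (X : Matrix (ι → A) (ι → A) ℂ) : (prodMap Φ X).trace = X.trace := by
  have h1 : ∀ k a a', ∑ b, Φ k (Matrix.single a a' 1) b b = if a = a' then 1 else 0 := by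
    intro k a a'
    have := (hΦ k).trace_preserving (Matrix.single a a' 1)
    rw [show ∑ b, Φ k (Matrix.single a a' 1) b b = (Φ k (Matrix.single a a' 1)).trace from rfl,
      this]
    split_ifs with h
    · subst h; exact trace_single_eq_same _ _
    · exact trace_single_eq_of_ne _ _ _ h
  simp only [Matrix.trace, diag_apply, prodMap_apply]
  rw [Finset.sum_comm]
  refine Finset.sum_congr rfl fun a _ => ?_
  rw [Finset.sum_comm]
  have h2 : ∀ a' : ι → A, ∑ b : ι → B, X a a' *
      ∏ k, Φ k (Matrix.single (a k) (a' k) 1) (b k) (b k) = if a = a' then X a a' else 0 := by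
    intro a'
    rw [← Finset.mul_sum, ← prod_sum_eq fun k b => Φ k (Matrix.single (a k) (a' k) 1) b b]
    simp only [h1, Finset.prod_ite_zero, Finset.prod_const_one, Finset.mem_univ, true_imp_iff,
      funext_iff, mul_ite, mul_one, mul_zero]
  rw [Finset.sum_congr rfl fun a' _ => h2 a', Finset.sum_ite_eq, if_pos (Finset.mem_univ _)]

theorem preservesStates_prodMap {Φ : ι → Matrix A A ℂ →ₗ[ℂ] Matrix B B ℂ}
    (hΦ : ∀ k, IsChannel (Φ k)) : PreservesStates (prodMap Φ) := fun _ hρ =>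
  ⟨posSemidef_prodMap hΦ hρ.1, (trace_prodMap hΦ _).trans hρ.2⟩

/-- Relabelling tensor factors; it carries facts about `Fin n` to the subtypes of positions where a
given channel acts. -/
theorem prodMap_submatrix {κ : Type*} [Fintype κ] [DecidableEq κ]
    (Φ : ι → Matrix A A ℂ →ₗ[ℂ] Matrix B B ℂ) (e : κ ≃ ι) (X : Matrix (ι → A) (ι → A) ℂ) :
    (prodMap Φ X).submatrix (e.arrowCongr (Equiv.refl B)) (e.arrowCongr (Equiv.refl B)) =
      prodMap (fun k => Φ (e k))
        (X.submatrix (e.arrowCongr (Equiv.refl A)) (e.arrowCongr (Equiv.refl A))) := by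
  ext b b'
  simp only [submatrix_apply, prodMap_apply]
  rw [← Equiv.sum_comp (e.arrowCongr (Equiv.refl A))]
  refine Finset.sum_congr rfl fun a _ => ?_
  rw [← Equiv.sum_comp (e.arrowCongr (Equiv.refl A))]
  refine Finset.sum_congr rfl fun a' _ => ?_
  rw [← Equiv.prod_comp e]
  simp [Equiv.arrowCongr]

end ProdMap

/-! ### Block decomposition of the conditional channel -/

section Conditional

variable {A B : Type*} [Fintype A] [DecidableEq A] [Fintype B] [DecidableEq B]

theorem conditionalChannel_single (N : Fin 2 → Matrix A A ℂ →ₗ[ℂ] Matrix B B ℂ)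
    (x y : Fin 2 × A) : conditionalChannel (N 0) (N 1) (Matrix.single x y 1) =
      if x.1 = y.1 then N x.1 (Matrix.single x.2 y.2 1) else 0 := by
  have h : ∀ i : Fin 2, (Matrix.single x y (1 : ℂ)).submatrix (Prod.mk i) (Prod.mk i) =
      if x.1 = i ∧ y.1 = i then Matrix.single x.2 y.2 1 else 0 := by
    intro i
    ext a b
    obtain ⟨x1, x2⟩ := x
    obtain ⟨y1, y2⟩ := y
    simp only [submatrix_apply, single_apply, Prod.mk.injEq]
    split_ifs with h1 h2 h2 <;> simp_all
  change N 0 (submatrix _ _ _) + N 1 (submatrix _ _ _) = _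
  rw [h, h]
  obtain ⟨x1, x2⟩ := x
  obtain ⟨y1, y2⟩ := y
  fin_cases x1 <;> fin_cases y1 <;> simp

/-- Coherences between distinct control strings are erased, as some factor meets a matrix unit
off-diagonal in its control. Only the diagonal blocks survive. -/
theorem tensorPower_conditionalChannel (N : Fin 2 → Matrix A A ℂ →ₗ[ℂ] Matrix B B ℂ) (n : ℕ)
    (X : Matrix (Fin n → Fin 2 × A) (Fin n → Fin 2 × A) ℂ) :
    tensorPower (conditionalChannel (N 0) (N 1)) n X =
      ∑ m : Fin n → Fin 2, prodMap (fun k => N (m k))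
        (X.submatrix (fun a k => (m k, a k)) (fun a k => (m k, a k))) := by
  ext b b'
  rw [tensorPower_eq_prodMap, prodMap_apply, Matrix.sum_apply]
  let e := (Equiv.arrowProdEquivProdArrow (Fin n) (fun _ => Fin 2) (fun _ => A)).symm
  rw [← Equiv.sum_comp e, Fintype.sum_prod_type]
  refine Finset.sum_congr rfl fun m _ => ?_
  rw [prodMap_apply]
  refine Finset.sum_congr rfl fun a _ => ?_
  rw [← Equiv.sum_comp e, Fintype.sum_prod_type, Finset.sum_eq_single m]
  · refine Finset.sum_congr rfl fun a' _ => ?_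
    simp only [conditionalChannel_single, e]
    simp [Equiv.arrowProdEquivProdArrow]
  · intro m' _ hm
    refine Finset.sum_eq_zero fun a' _ => ?_
    obtain ⟨k, hk⟩ := Function.ne_iff.1 hm
    rw [Finset.prod_eq_zero (Finset.mem_univ k), mul_zero]
    rw [conditionalChannel_single, if_neg, Matrix.zero_apply]
    exact fun h => hk h.symm
  · simp

theorem trace_sum_blocks (n : ℕ) (X : Matrix (Fin n → Fin 2 × A) (Fin n → Fin 2 × A) ℂ) :
    ∑ m : Fin n → Fin 2, (X.submatrix (fun (a : Fin n → A) k => (m k, a k))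
      (fun a k => (m k, a k))).trace = X.trace := by
  let e := (Equiv.arrowProdEquivProdArrow (Fin n) (fun _ => Fin 2) (fun _ => A)).symm
  rw [Matrix.trace, ← Equiv.sum_comp e, Fintype.sum_prod_type]
  rfl

theorem preservesStates_tensorPower_conditionalChannel
    {N : Fin 2 → Matrix A A ℂ →ₗ[ℂ] Matrix B B ℂ} (hN : ∀ i, IsChannel (N i)) (n : ℕ) :
    PreservesStates (tensorPower (conditionalChannel (N 0) (N 1)) n) := by
  intro ρ hρ
  rw [tensorPower_conditionalChannel]
  refine ⟨posSemidef_sum _ fun m _ =>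
    posSemidef_prodMap (fun k => hN (m k)) (hρ.1.submatrix _), ?_⟩
  rw [trace_sum]
  simp only [trace_prodMap fun k => hN _]
  rw [trace_sum_blocks, hρ.2]

end Conditional

/-! ### Holevo capacity, superadditivity and the regularized limit -/

section Capacity

variable {A B A' B' : Type*} [Fintype A] [DecidableEq A] [Fintype B] [DecidableEq B]
  [Fintype A'] [DecidableEq A'] [Fintype B'] [DecidableEq B']

theorem exists_isState (A : Type*) [Fintype A] [DecidableEq A] [Nonempty A] :
    ∃ ρ : Matrix A A ℂ, IsState ρ :=
  ⟨ofEigen 1 (fun _ => 1 / Fintype.card A),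
    isState_ofEigen (one_mem _) (fun _ => by positivity) (by simp)⟩

theorem nonempty_ensemble (A : Type*) [Fintype A] [DecidableEq A] [Nonempty A] :
    Nonempty (Ensemble A) := by
  obtain ⟨ρ, hρ⟩ := exists_isState A
  exact ⟨⟨1, fun _ => 1, fun _ => ρ, fun _ => zero_le_one, by simp, fun _ => hρ⟩⟩

theorem holevoInfo_le_log {Φ : Matrix A A ℂ →ₗ[ℂ] Matrix B B ℂ} (hΦ : PreservesStates Φ)
    (𝓔 : Ensemble A) : holevoInfo Φ 𝓔 ≤ Real.log (Fintype.card B) := by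
  have h1 := (isState_sum 𝓔.p_nonneg 𝓔.p_sum fun i => hΦ _ (𝓔.isState i)).vonNeumannEntropy_le
  have h2 : 0 ≤ ∑ i, 𝓔.p i * vonNeumannEntropy (Φ (𝓔.ρ i)) :=
    Finset.sum_nonneg fun i _ =>
      mul_nonneg (𝓔.p_nonneg i) (hΦ _ (𝓔.isState i)).vonNeumannEntropy_nonneg
  rw [holevoInfo]
  linarith

theorem bddAbove_holevoInfo {Φ : Matrix A A ℂ →ₗ[ℂ] Matrix B B ℂ} (hΦ : PreservesStates Φ) :
    BddAbove (Set.range (holevoInfo Φ)) :=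
  ⟨_, Set.forall_mem_range.2 (holevoInfo_le_log hΦ)⟩

theorem oneShotCapacity_le [Nonempty A] {Φ : Matrix A A ℂ →ₗ[ℂ] Matrix B B ℂ} {c : ℝ}
    (h : ∀ 𝓔, holevoInfo Φ 𝓔 ≤ c) : oneShotCapacity Φ ≤ c := by
  have := nonempty_ensemble A
  exact csSup_le (Set.range_nonempty _) (Set.forall_mem_range.2 h)

theorem holevoInfo_le_oneShotCapacity {Φ : Matrix A A ℂ →ₗ[ℂ] Matrix B B ℂ}
    (hΦ : PreservesStates Φ) (𝓔 : Ensemble A) : holevoInfo Φ 𝓔 ≤ oneShotCapacity Φ :=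
  le_csSup (bddAbove_holevoInfo hΦ) (Set.mem_range_self _)

/-- Allows ensembles indexed by any finite type, such as pairs or measurement outcomes. -/
theorem holevo_le_oneShotCapacity {ι : Type*} [Fintype ι] {Φ : Matrix A A ℂ →ₗ[ℂ] Matrix B B ℂ}
    (hΦ : PreservesStates Φ) {p : ι → ℝ} (hp : ∀ i, 0 ≤ p i) (hp1 : ∑ i, p i = 1)
    {ρ : ι → Matrix A A ℂ} (hρ : ∀ i, IsState (ρ i)) :
    vonNeumannEntropy (∑ i, (p i : ℂ) • Φ (ρ i)) - ∑ i, p i * vonNeumannEntropy (Φ (ρ i)) ≤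
      oneShotCapacity Φ := by
  let e := (Fintype.equivFin ι).symm
  have := holevoInfo_le_oneShotCapacity hΦ ⟨Fintype.card ι, fun i => p (e i), fun i => ρ (e i),
    fun i => hp _, by rw [Equiv.sum_comp e p, hp1], fun i => hρ _⟩
  rw [holevoInfo] at this
  rwa [Equiv.sum_comp e fun i => (p i : ℂ) • Φ (ρ i),
    Equiv.sum_comp e fun i => p i * vonNeumannEntropy (Φ (ρ i))] at this

theorem oneShotCapacity_nonneg [Nonempty A] {Φ : Matrix A A ℂ →ₗ[ℂ] Matrix B B ℂ}
    (hΦ : PreservesStates Φ) : 0 ≤ oneShotCapacity Φ := by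
  obtain ⟨ρ, hρ⟩ := exists_isState A
  have := holevo_le_oneShotCapacity hΦ (p := fun _ : Unit => 1) (fun _ => zero_le_one) (by simp)
    (ρ := fun _ => ρ) (fun _ => hρ)
  simpa using this

theorem oneShotCapacity_le_log [Nonempty A] {Φ : Matrix A A ℂ →ₗ[ℂ] Matrix B B ℂ}
    (hΦ : PreservesStates Φ) : oneShotCapacity Φ ≤ Real.log (Fintype.card B) :=
  oneShotCapacity_le (holevoInfo_le_log hΦ)

/-- A channel that can simulate another one has the larger capacity. -/
theorem oneShotCapacity_le_of_simulates [Nonempty A] {Φ : Matrix A A ℂ →ₗ[ℂ] Matrix B B ℂ}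
    (hΦ : PreservesStates Φ)
    {Ψ : Matrix A' A' ℂ →ₗ[ℂ] Matrix B' B' ℂ} (hΨ : PreservesStates Ψ) (e : B' ≃ B)
    (h : ∀ ρ, IsState ρ → ∃ σ, IsState σ ∧ Ψ σ = (Φ ρ).submatrix e e) :
    oneShotCapacity Φ ≤ oneShotCapacity Ψ := by
  refine oneShotCapacity_le fun 𝓔 => ?_
  choose σ hσ hσ' using fun i => h _ (𝓔.isState i)
  refine le_trans (le_of_eq ?_) (holevo_le_oneShotCapacity hΨ 𝓔.p_nonneg 𝓔.p_sum hσ)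
  have h1 : ∑ i, (𝓔.p i : ℂ) • Ψ (σ i) =
      (∑ i, (𝓔.p i : ℂ) • Φ (𝓔.ρ i)).submatrix e e := by
    ext b b'
    simp only [hσ', Matrix.sum_apply, submatrix_apply, Matrix.smul_apply]
  rw [h1, vonNeumannEntropy_submatrix
    (isState_sum 𝓔.p_nonneg 𝓔.p_sum fun i => hΦ _ (𝓔.isState i)).1.1, holevoInfo]
  simp only [hσ', vonNeumannEntropy_submatrix (hΦ _ (𝓔.isState _)).1.1]

theorem submatrix_funUnique_eq_prodMatrix (M : Matrix A A ℂ) :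
    M.submatrix (Equiv.funUnique (Fin 1) A) (Equiv.funUnique (Fin 1) A) =
      prodMatrix (fun _ : Fin 1 => M) := by
  ext a b
  simp [prodMatrix_apply]

theorem tensorPower_one_submatrix (Φ : Matrix A A ℂ →ₗ[ℂ] Matrix B B ℂ) (ρ : Matrix A A ℂ) :
    tensorPower Φ 1 (ρ.submatrix (Equiv.funUnique (Fin 1) A) (Equiv.funUnique (Fin 1) A)) =
      (Φ ρ).submatrix (Equiv.funUnique (Fin 1) B) (Equiv.funUnique (Fin 1) B) := by
  rw [submatrix_funUnique_eq_prodMatrix, submatrix_funUnique_eq_prodMatrix,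
    tensorPower_eq_prodMap, prodMap_prodMatrix]

theorem preservesStates_of_tensorPower_one {Φ : Matrix A A ℂ →ₗ[ℂ] Matrix B B ℂ}
    (hΦ : PreservesStates (tensorPower Φ 1)) : PreservesStates Φ := by
  intro ρ hρ
  have := (hΦ _ (hρ.submatrix (Equiv.funUnique (Fin 1) A))).submatrix
    (Equiv.funUnique (Fin 1) B).symm
  rwa [tensorPower_one_submatrix, submatrix_submatrix, Equiv.self_comp_symm,
    submatrix_id_id] at this

theorem oneShotCapacity_tensorPower_one [Nonempty A] {Φ : Matrix A A ℂ →ₗ[ℂ] Matrix B B ℂ}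
    (hΦ : PreservesStates (tensorPower Φ 1)) :
    oneShotCapacity (tensorPower Φ 1) = oneShotCapacity Φ := by
  have hΦ' := preservesStates_of_tensorPower_one hΦ
  refine le_antisymm (oneShotCapacity_le_of_simulates hΦ hΦ' (Equiv.funUnique (Fin 1) B).symm ?_)
    (oneShotCapacity_le_of_simulates hΦ' hΦ (Equiv.funUnique (Fin 1) B) ?_)
  · intro ρ hρ
    refine ⟨_, hρ.submatrix (Equiv.funUnique (Fin 1) A).symm, ?_⟩
    have := tensorPower_one_submatrix Φ (ρ.submatrix (Equiv.funUnique (Fin 1) A).symm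
      (Equiv.funUnique (Fin 1) A).symm)
    rw [submatrix_submatrix, Equiv.symm_comp_self, submatrix_id_id] at this
    rw [this, submatrix_submatrix, Equiv.self_comp_symm, submatrix_id_id]
  · intro ρ hρ
    exact ⟨_, hρ.submatrix _, tensorPower_one_submatrix Φ ρ⟩

theorem tensorPower_add_kronecker (Φ : Matrix A A ℂ →ₗ[ℂ] Matrix B B ℂ) (m n : ℕ)
    (ρ : Matrix (Fin m → A) (Fin m → A) ℂ) (σ : Matrix (Fin n → A) (Fin n → A) ℂ) :
    tensorPower Φ (m + n) ((kroneckerMap (· * ·) ρ σ).submatrix (Fin.appendEquiv m n).symm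
      (Fin.appendEquiv m n).symm) =
    (kroneckerMap (· * ·) (tensorPower Φ m ρ) (tensorPower Φ n σ)).submatrix
      (Fin.appendEquiv m n).symm (Fin.appendEquiv m n).symm := by
  ext b b'
  obtain ⟨⟨b1, b2⟩, rfl⟩ := (Fin.appendEquiv m n).surjective b
  obtain ⟨⟨b1', b2'⟩, rfl⟩ := (Fin.appendEquiv m n).surjective b'
  simp only [submatrix_apply, Equiv.symm_apply_apply, kroneckerMap_apply, tensorPower_eq_prodMap,
    prodMap_apply]
  rw [← Equiv.sum_comp (Fin.appendEquiv m n), Fintype.sum_prod_type, Finset.sum_mul_sum]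
  refine Finset.sum_congr rfl fun a1 _ => Finset.sum_congr rfl fun a2 _ => ?_
  rw [← Equiv.sum_comp (Fin.appendEquiv m n), Fintype.sum_prod_type, Finset.sum_mul_sum]
  refine Finset.sum_congr rfl fun a1' _ => Finset.sum_congr rfl fun a2' _ => ?_
  simp only [Equiv.symm_apply_apply, Fin.prod_univ_add]
  simp only [Fin.appendEquiv, Equiv.coe_fn_mk, Fin.append_left, Fin.append_right]
  ring

/-- Holevo information is additive on product ensembles, since entropy is additive on product
states. -/
theorem add_le_oneShotCapacity_tensorPower [Nonempty A] {Φ : Matrix A A ℂ →ₗ[ℂ] Matrix B B ℂ}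
    (hΦ : ∀ n, PreservesStates (tensorPower Φ n)) (m n : ℕ) :
    oneShotCapacity (tensorPower Φ m) + oneShotCapacity (tensorPower Φ n) ≤
      oneShotCapacity (tensorPower Φ (m + n)) := by
  have key : ∀ (𝓔 : Ensemble (Fin m → A)) (𝓕 : Ensemble (Fin n → A)),
      holevoInfo (tensorPower Φ m) 𝓔 + holevoInfo (tensorPower Φ n) 𝓕 ≤
        oneShotCapacity (tensorPower Φ (m + n)) := by
    intro 𝓔 𝓕
    have hm := fun i => hΦ m _ (𝓔.isState i)
    have hn := fun i => hΦ n _ (𝓕.isState i)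
    have h := holevo_le_oneShotCapacity (hΦ (m + n))
      (p := fun i : Fin 𝓔.size × Fin 𝓕.size => 𝓔.p i.1 * 𝓕.p i.2)
      (fun i => mul_nonneg (𝓔.p_nonneg _) (𝓕.p_nonneg _))
      (by rw [Fintype.sum_prod_type, ← Finset.sum_mul_sum, 𝓔.p_sum, 𝓕.p_sum, one_mul])
      (fun i => ((𝓔.isState i.1).kronecker (𝓕.isState i.2)).submatrix (Fin.appendEquiv m n).symm)
    refine le_trans (le_of_eq ?_) h
    simp only [tensorPower_add_kronecker, vonNeumannEntropy_submatrix ((hm _).kronecker (hn _)).1.1,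
      vonNeumannEntropy_kronecker (hm _) (hn _)]
    have hs : ∑ i : Fin 𝓔.size × Fin 𝓕.size, ((𝓔.p i.1 * 𝓕.p i.2 : ℝ) : ℂ) •
        (kroneckerMap (· * ·) (tensorPower Φ m (𝓔.ρ i.1)) (tensorPower Φ n (𝓕.ρ i.2))).submatrix
          (Fin.appendEquiv m n).symm (Fin.appendEquiv m n).symm =
        (kroneckerMap (· * ·) (∑ i, (𝓔.p i : ℂ) • tensorPower Φ m (𝓔.ρ i))
          (∑ i, (𝓕.p i : ℂ) • tensorPower Φ n (𝓕.ρ i))).submatrix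
          (Fin.appendEquiv m n).symm (Fin.appendEquiv m n).symm := by
      ext b b'
      simp only [Matrix.sum_apply, Matrix.smul_apply, submatrix_apply, kroneckerMap_apply,
        Fintype.sum_prod_type, Finset.sum_mul_sum, smul_eq_mul]
      refine Finset.sum_congr rfl fun i _ => Finset.sum_congr rfl fun j _ => ?_
      push_cast
      ring
    have h1 := isState_sum 𝓔.p_nonneg 𝓔.p_sum hm
    have h2 := isState_sum 𝓕.p_nonneg 𝓕.p_sum hn
    rw [hs, vonNeumannEntropy_submatrix (h1.kronecker h2).1.1, vonNeumannEntropy_kronecker h1 h2,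
      holevoInfo, holevoInfo, Fintype.sum_prod_type]
    have h3 : ∑ i, ∑ j, 𝓔.p i * 𝓕.p j * (vonNeumannEntropy (tensorPower Φ m (𝓔.ρ i)) +
        vonNeumannEntropy (tensorPower Φ n (𝓕.ρ j))) =
        ∑ i, 𝓔.p i * vonNeumannEntropy (tensorPower Φ m (𝓔.ρ i)) * ∑ j, 𝓕.p j +
        (∑ i, 𝓔.p i) * ∑ j, 𝓕.p j * vonNeumannEntropy (tensorPower Φ n (𝓕.ρ j)) := by
      rw [Finset.sum_mul, ← Finset.sum_add_distrib]
      refine Finset.sum_congr rfl fun i _ => ?_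
      rw [Finset.mul_sum, Finset.mul_sum, ← Finset.sum_add_distrib]
      exact Finset.sum_congr rfl fun j _ => by ring
    rw [h3, 𝓔.p_sum, 𝓕.p_sum]
    simp only [mul_one, one_mul]
    ring
  -- The two suprema are taken one after the other.
  rw [← le_sub_iff_add_le]
  refine oneShotCapacity_le fun 𝓔 => ?_
  rw [le_sub_comm]
  refine oneShotCapacity_le fun 𝓕 => ?_
  linarith [key 𝓔 𝓕]

theorem oneShotCapacity_tensorPower_le_mul_log [Nonempty A]
    {Φ : Matrix A A ℂ →ₗ[ℂ] Matrix B B ℂ} {n : ℕ} (hΦ : PreservesStates (tensorPower Φ n)) :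
    oneShotCapacity (tensorPower Φ n) ≤ n * Real.log (Fintype.card B) := by
  refine (oneShotCapacity_le_log hΦ).trans (le_of_eq ?_)
  simp

/-- The regularized capacity exists and is the supremum of the `n`-shot capacities. -/
theorem tendsto_nShotCapacity [Nonempty A] {Φ : Matrix A A ℂ →ₗ[ℂ] Matrix B B ℂ}
    (hΦ : ∀ n, PreservesStates (tensorPower Φ n)) :
    Tendsto (nShotCapacity Φ) atTop (𝓝 (classicalCapacity Φ)) ∧
      ∀ n : ℕ, oneShotCapacity (tensorPower Φ n) ≤ n * classicalCapacity Φ := by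
  -- Fekete's lemma concerns subadditive sequences, hence the sign.
  have hsub : Subadditive fun n => -oneShotCapacity (tensorPower Φ n) := by
    intro m n
    have := add_le_oneShotCapacity_tensorPower hΦ m n
    linarith
  have hbdd : BddBelow (Set.range fun n : ℕ => -oneShotCapacity (tensorPower Φ n) / n) := by
    refine ⟨-Real.log (Fintype.card B), Set.forall_mem_range.2 fun n => ?_⟩
    have := oneShotCapacity_tensorPower_le_mul_log (hΦ n)
    rcases n.eq_zero_or_pos with rfl | hn
    · simpa using Real.log_natCast_nonneg _
    · rw [le_div_iff₀ (by exact_mod_cast hn)]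
      linarith
  have hlim : Tendsto (nShotCapacity Φ) atTop (𝓝 (-hsub.lim)) := by
    have := (hsub.tendsto_lim hbdd).neg
    refine this.congr fun n => ?_
    rw [nShotCapacity]
    ring
  have hC : classicalCapacity Φ = -hsub.lim := hlim.limUnder_eq
  refine ⟨hC ▸ hlim, fun n => ?_⟩
  -- The zeroth power acts on a one-dimensional space, so its capacity is at most zero.
  rcases n.eq_zero_or_pos with rfl | hn
  · simpa using oneShotCapacity_tensorPower_le_mul_log (hΦ 0)
  · have := hsub.lim_le_div hbdd hn.ne'
    rw [le_div_iff₀ (by exact_mod_cast hn)] at this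
    rw [hC]
    linarith

theorem minOutputEntropy_le {Φ : Matrix A A ℂ →ₗ[ℂ] Matrix B B ℂ} (hΦ : PreservesStates Φ)
    {ρ : Matrix A A ℂ} (hρ : IsState ρ) : minOutputEntropy Φ ≤ vonNeumannEntropy (Φ ρ) := by
  refine csInf_le ⟨0, ?_⟩ ⟨ρ, hρ, rfl⟩
  rintro x ⟨σ, hσ, rfl⟩
  exact (hΦ _ hσ).vonNeumannEntropy_nonneg

end Capacity

/-! ### Pure states and the assisted capacity at `P = 0` -/

section Pure

variable {A B : Type*} [Fintype A] [DecidableEq A] [Fintype B] [DecidableEq B]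

theorem isState_vecMulVec {φ : A → ℂ} (hφ : ∑ a, φ a * star (φ a) = 1) :
    IsState (vecMulVec φ (star φ)) :=
  ⟨posSemidef_vecMulVec_self_star φ, by rw [trace_vecMulVec]; exact hφ⟩

theorem vecMulVec_mul_self {φ : A → ℂ} (hφ : ∑ a, φ a * star (φ a) = 1) :
    vecMulVec φ (star φ) * vecMulVec φ (star φ) = vecMulVec φ (star φ) := by
  rw [vecMulVec_mul_vecMulVec]
  have : star φ ⬝ᵥ φ = 1 := by rw [dotProduct_comm]; exact hφ
  rw [this, one_smul]

/-- Pure states have no entropy. -/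
theorem vonNeumannEntropy_vecMulVec {φ : A → ℂ} (hφ : ∑ a, φ a * star (φ a) = 1) :
    vonNeumannEntropy (vecMulVec φ (star φ)) = 0 := by
  obtain ⟨U, hU, d, -, -, h⟩ := (isState_vecMulVec hφ).exists_ofEigen
  have hU1 : Uᴴ * U = 1 := (mem_unitaryGroup_iff').1 hU
  have h1 : Uᴴ * ofEigen U d * U = diagonal (fun i => (d i : ℂ)) := by
    rw [ofEigen, show ∀ a b c : Matrix A A ℂ, a * (b * c * a) * b = (a * b) * (c * (a * b)) from
      fun a b c => by simp only [Matrix.mul_assoc], hU1, Matrix.one_mul, Matrix.mul_one]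
  have h2 : ofEigen U d * ofEigen U d = ofEigen U (fun i => d i * d i) := by
    simp only [ofEigen]
    rw [show ∀ a b c : Matrix A A ℂ, a * b * c * (a * b * c) = a * (b * ((c * a) * b)) * c from
      fun a b c => by simp only [Matrix.mul_assoc], hU1, Matrix.one_mul, diagonal_mul_diagonal]
    push_cast; rfl
  have h3 : Uᴴ * ofEigen U (fun i => d i * d i) * U =
      diagonal (fun i => ((d i * d i : ℝ) : ℂ)) := by
    rw [ofEigen, show ∀ a b c : Matrix A A ℂ, a * (b * c * a) * b = (a * b) * (c * (a * b)) from
      fun a b c => by simp only [Matrix.mul_assoc], hU1, Matrix.one_mul, Matrix.mul_one]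
  -- Idempotence gives `d i = d i * d i`, so every eigenvalue is `0` or `1`.
  have h4 := vecMulVec_mul_self hφ
  rw [h, h2] at h4
  rw [h4, h1] at h3
  rw [h, vonNeumannEntropy_ofEigen hU]
  refine Finset.sum_eq_zero fun i _ => ?_
  have h5 := congrFun (diagonal_injective h3) i
  have h6 : d i = d i * d i := by exact_mod_cast h5
  rcases mul_eq_zero.1 (show d i * (d i - 1) = 0 by linarith) with h7 | h7
  · rw [h7, negMulLog_zero]
  · rw [sub_eq_zero.1 h7, negMulLog_one]

/-- All terms of the entropy are nonnegative, hence zero; the eigenvalues are then `0` or `1`, and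
trace one leaves a single `1`. -/
theorem IsState.exists_vecMulVec {ρ : Matrix A A ℂ} (hρ : IsState ρ)
    (h : vonNeumannEntropy ρ ≤ 0) :
    ∃ φ : A → ℂ, ∑ a, φ a * star (φ a) = 1 ∧ ρ = vecMulVec φ (star φ) := by
  obtain ⟨U, hU, d, hd, h1, rfl⟩ := hρ.exists_ofEigen
  rw [vonNeumannEntropy_ofEigen hU] at h
  have hle := le_one_of_sum_eq_one hd h1
  have h0 : ∀ i, negMulLog (d i) = 0 := by
    have hn : ∀ i ∈ Finset.univ, 0 ≤ negMulLog (d i) := fun i _ => negMulLog_nonneg (hd i) (hle i)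
    have := (Finset.sum_eq_zero_iff_of_nonneg hn).1 (le_antisymm h (Finset.sum_nonneg hn))
    exact fun i => this i (Finset.mem_univ i)
  have h01 : ∀ i, d i = 0 ∨ d i = 1 := by
    intro i
    have := h0 i
    rw [negMulLog, mul_eq_zero, neg_eq_zero, Real.log_eq_zero] at this
    have := hd i
    grind
  obtain ⟨i, hi⟩ : ∃ i, d i = 1 := by
    by_contra! hne
    rw [Finset.sum_eq_zero fun i _ => (h01 i).resolve_right (hne i)] at h1
    exact zero_ne_one h1
  have hj : ∀ j, j ≠ i → d j = 0 := by
    intro j hj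
    refine (h01 j).resolve_right fun h2 => ?_
    have := Finset.add_le_sum (f := d) (s := Finset.univ) (fun i _ => hd i) (Finset.mem_univ i)
      (Finset.mem_univ j) hj.symm
    linarith
  refine ⟨fun a => U a i, ?_, ?_⟩
  · have := sum_normSq_col hU i
    simp only [RCLike.star_def, Complex.mul_conj]
    exact_mod_cast this
  · ext a b
    rw [ofEigen_apply, Finset.sum_eq_single i]
    · simp [hi, vecMulVec_apply]
    · intro j _ hji
      simp [hj j hji]
    · simp

/-- Every purification of a pure state is a product vector. -/
theorem IsPurification.exists_eq_mul {φ : A → ℂ} (hφ : ∑ a, φ a * star (φ a) = 1)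
    {ψ : A × A → ℂ} (hψ : IsPurification ψ (vecMulVec φ (star φ))) :
    ∃ χ : A → ℂ, ∑ e, χ e * star (χ e) = 1 ∧ ∀ a e, ψ (a, e) = φ a * χ e := by
  set P := vecMulVec φ (star φ) with hP
  let Ψ : Matrix A A ℂ := Matrix.of fun a e => ψ (a, e)
  have h1 : Ψ * Ψᴴ = P := by
    ext a a'
    exact hψ a a'
  have hPP : P * P = P := vecMulVec_mul_self hφ
  have hPH : Pᴴ = P := (isState_vecMulVec hφ).1.1
  -- Since `Ψ Ψ† = P` is a projection, all four terms of the expansion equal `P` and cancel. So `Ψ =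
  -- P Ψ` has its columns along `φ`, and `χ` collects their coefficients.
  have h2 : (Ψ - P * Ψ) * (Ψ - P * Ψ)ᴴ = 0 := by
    rw [conjTranspose_sub, conjTranspose_mul, hPH, Matrix.sub_mul, Matrix.mul_sub, Matrix.mul_sub,
      h1, ← Matrix.mul_assoc, h1, Matrix.mul_assoc P, h1, Matrix.mul_assoc P Ψ,
      ← Matrix.mul_assoc Ψ, h1, hPP, hPP]
    simp
  have h3 : Ψ = P * Ψ := sub_eq_zero.1 (self_mul_conjTranspose_eq_zero.1 h2)
  have h4 : ∀ a e, ψ (a, e) = φ a * ∑ c, star (φ c) * ψ (c, e) := by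
    intro a e
    refine (congrFun (congrFun h3 a) e).trans ?_
    simp only [Matrix.mul_apply, hP, vecMulVec_apply, Finset.mul_sum, Ψ, of_apply, Pi.star_apply,
      mul_assoc]
  refine ⟨_, ?_, h4⟩
  obtain ⟨a, ha⟩ : ∃ a, φ a ≠ 0 := by
    by_contra! h
    simp [h] at hφ
  have h5 := hψ a a
  simp only [h4 a, star_mul', hP, vecMulVec_apply, Pi.star_apply] at h5
  have h6 : φ a * star (φ a) ≠ 0 := mul_ne_zero ha (star_ne_zero.2 ha)
  refine mul_left_cancel₀ h6 ?_
  rw [mul_one]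
  refine Eq.trans ?_ h5
  rw [Finset.mul_sum]
  exact Finset.sum_congr rfl fun e _ => by rw [mul_mul_mul_comm]

/-- The purification is a product `φ ⊗ χ`, so the joint output is a product whose reference factor
is pure. -/
theorem jointOutputEntropy_of_pure {Φ : Matrix A A ℂ →ₗ[ℂ] Matrix B B ℂ} (hΦ : PreservesStates Φ)
    {φ : A → ℂ} (hφ : ∑ a, φ a * star (φ a) = 1) {ψ : A × A → ℂ}
    (hψ : IsPurification ψ (vecMulVec φ (star φ))) :
    jointOutputEntropy Φ ψ = vonNeumannEntropy (Φ (vecMulVec φ (star φ))) := by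
  obtain ⟨χ, hχ, h⟩ := hψ.exists_eq_mul hφ
  have h1 : tensorId Φ A (vecMulVec ψ (star ψ)) =
      kroneckerMap (· * ·) (Φ (vecMulVec φ (star φ))) (vecMulVec χ (star χ)) := by
    ext i j
    have h2 : (vecMulVec ψ (star ψ)).submatrix (fun a => (a, i.2)) (fun a => (a, j.2)) =
        (vecMulVec χ (star χ) i.2 j.2) • vecMulVec φ (star φ) := by
      ext a a'
      simp only [submatrix_apply, vecMulVec_apply, h, Pi.star_apply, star_mul', Matrix.smul_apply,
        smul_eq_mul]
      ring
    change Φ ((vecMulVec ψ (star ψ)).submatrix (fun a => (a, i.2)) (fun a => (a, j.2))) i.1 j.1 = _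
    rw [h2, map_smul, Matrix.smul_apply, kroneckerMap_apply, smul_eq_mul, mul_comm]
  rw [jointOutputEntropy, h1, vonNeumannEntropy_kronecker (hΦ _ (isState_vecMulVec hφ))
    (isState_vecMulVec hχ), vonNeumannEntropy_vecMulVec hχ, add_zero]

theorem isPurification_mul {φ : A → ℂ} (hφ : ∑ a, φ a * star (φ a) = 1) :
    IsPurification (fun x : A × A => φ x.1 * φ x.2) (vecMulVec φ (star φ)) := by
  intro a a'
  simp only [star_mul', vecMulVec_apply, Pi.star_apply]
  calc _ = ∑ e, φ a * star (φ a') * (φ e * star (φ e)) :=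
        Finset.sum_congr rfl fun e _ => by ring
    _ = _ := by rw [← Finset.mul_sum, hφ, mul_one]

/-- Without entanglement, the assisted capacity is at most the unassisted one. -/
theorem assistedOneShotCapacity_zero_le [Nonempty A] {Φ : Matrix A A ℂ →ₗ[ℂ] Matrix B B ℂ}
    (hΦ : PreservesStates Φ) : assistedOneShotCapacity Φ 0 ≤ oneShotCapacity Φ := by
  -- Nonnegativity of the bound covers the default value of an empty supremum.
  refine Real.sSup_le ?_ (oneShotCapacity_nonneg hΦ)
  rintro x ⟨𝓔, ψ, hψ, hP, rfl⟩
  have hn : ∀ i ∈ Finset.univ, 0 ≤ 𝓔.p i * vonNeumannEntropy (𝓔.ρ i) := fun i _ =>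
    mul_nonneg (𝓔.p_nonneg i) (𝓔.isState i).vonNeumannEntropy_nonneg
  have h0 := le_antisymm hP (Finset.sum_nonneg hn)
  have h1 := (Finset.sum_eq_zero_iff_of_nonneg hn).1 h0
  -- A zero entropy budget forces each member of the ensemble to be pure or to have weight zero.
  have h2 : ∑ i, 𝓔.p i * jointOutputEntropy Φ (ψ i) =
      ∑ i, 𝓔.p i * vonNeumannEntropy (Φ (𝓔.ρ i)) := by
    refine Finset.sum_congr rfl fun i hi => ?_
    rcases mul_eq_zero.1 (h1 i hi) with h | h
    · rw [h, zero_mul, zero_mul]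
    · obtain ⟨φ, hφ, h3⟩ := (𝓔.isState i).exists_vecMulVec h.le
      have h4 := hψ i
      rw [h3] at h4 ⊢
      rw [jointOutputEntropy_of_pure hΦ hφ h4]
  rw [h0, h2, zero_add, map_sum]
  simp only [map_smul]
  exact holevoInfo_le_oneShotCapacity hΦ 𝓔

theorem minEntropyGap_zero_le {Φ : Matrix A A ℂ →ₗ[ℂ] Matrix B B ℂ} {n : ℕ}
    (hΦ : PreservesStates (tensorPower Φ n)) {φ : (Fin n → A) → ℂ}
    (hφ : ∑ a, φ a * star (φ a) = 1) :
    minEntropyGap Φ n 0 ≤ 1 / n * vonNeumannEntropy (tensorPower Φ n (vecMulVec φ (star φ))) := by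
  refine csInf_le ⟨0, ?_⟩ ⟨_, _, isState_vecMulVec hφ, isPurification_mul hφ, ?_, ?_⟩
  · rintro x ⟨ρ, ψ, hρ, hψ, hS, rfl⟩
    rw [mul_zero] at hS
    obtain ⟨φ, hφ, rfl⟩ := hρ.exists_vecMulVec hS
    rw [jointOutputEntropy_of_pure hΦ hφ hψ, vonNeumannEntropy_vecMulVec hφ, sub_zero]
    exact mul_nonneg (by positivity) (hΦ _ hρ).vonNeumannEntropy_nonneg
  · rw [vonNeumannEntropy_vecMulVec hφ, mul_zero]
  · rw [jointOutputEntropy_of_pure hΦ hφ (isPurification_mul hφ), vonNeumannEntropy_vecMulVec hφ,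
      sub_zero]

theorem ofEigen_eq_sum_vecMulVec (U : Matrix A A ℂ) (d : A → ℝ) :
    ofEigen U d = ∑ i, (d i : ℂ) • vecMulVec (fun a => U a i) (star fun a => U a i) := by
  ext a b
  simp only [ofEigen_apply, Matrix.sum_apply, Matrix.smul_apply, vecMulVec_apply, smul_eq_mul,
    Pi.star_apply]

/-- The minimal output entropy is attained on pure states. -/
theorem le_vonNeumannEntropy_of_pure {Φ : Matrix A A ℂ →ₗ[ℂ] Matrix B B ℂ}
    (hΦ : PreservesStates Φ) {s : ℝ}
    (h : ∀ φ : A → ℂ, ∑ a, φ a * star (φ a) = 1 →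
      s ≤ vonNeumannEntropy (Φ (vecMulVec φ (star φ))))
    {ρ : Matrix A A ℂ} (hρ : IsState ρ) : s ≤ vonNeumannEntropy (Φ ρ) := by
  obtain ⟨U, hU, d, hd, h1, rfl⟩ := hρ.exists_ofEigen
  have hcol : ∀ i, ∑ a, U a i * star (U a i) = 1 := by
    intro i
    have := sum_normSq_col hU i
    simp only [RCLike.star_def, Complex.mul_conj]
    exact_mod_cast this
  rw [ofEigen_eq_sum_vecMulVec, map_sum]
  simp only [map_smul]
  refine le_trans ?_ (sum_mul_vonNeumannEntropy_le hd h1 fun i =>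
    (hΦ _ (isState_vecMulVec (hcol i))).1)
  calc s = ∑ i, d i * s := by rw [← Finset.sum_mul, h1, one_mul]
    _ ≤ _ := Finset.sum_le_sum fun i _ => mul_le_mul_of_nonneg_left (h _ (hcol i)) (hd i)

/-- For a pure input, `log|B|` is the entropy gap plus the assisted capacity at `P = 0`: the first
is at most the output entropy over `n`, the second at most the unassisted capacity over `n`.
Concavity extends this to mixed inputs. -/
theorem mul_log_sub_oneShotCapacity_le [Nonempty A] {Φ : Matrix A A ℂ →ₗ[ℂ] Matrix B B ℂ}
    (hΦ : ∀ n, PreservesStates (tensorPower Φ n))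
    (h : ∀ n : ℕ, 1 ≤ n →
      assistedNShotCapacity Φ n 0 = Real.log (Fintype.card B) - minEntropyGap Φ n 0)
    (n : ℕ) {ρ : Matrix (Fin n → A) (Fin n → A) ℂ} (hρ : IsState ρ) :
    n * Real.log (Fintype.card B) - oneShotCapacity (tensorPower Φ n) ≤
      vonNeumannEntropy (tensorPower Φ n ρ) := by
  -- The hypothesis starts at `n = 1`; for `n = 0` signs suffice.
  rcases n.eq_zero_or_pos with rfl | hn
  · have h1 := oneShotCapacity_nonneg (hΦ 0)
    have h2 := (hΦ 0 _ hρ).vonNeumannEntropy_nonneg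
    rw [Nat.cast_zero, zero_mul]
    linarith
  · refine le_vonNeumannEntropy_of_pure (hΦ n) (fun φ hφ => ?_) hρ
    have h1 := h n hn
    have h2 := minEntropyGap_zero_le (hΦ n) hφ
    have h3 := assistedOneShotCapacity_zero_le (hΦ n)
    have hn' : (0 : ℝ) < n := by exact_mod_cast hn
    rw [assistedNShotCapacity, mul_zero, div_eq_iff hn'.ne'] at h1
    rw [one_div, ← div_eq_inv_mul, le_div_iff₀ hn'] at h2
    linarith

end Pure

/-! ### Classical channels: additivity and partial measurement -/

section Classical

variable {A B ι : Type*} [Fintype A] [DecidableEq A] [Fintype B] [DecidableEq B]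
  [Fintype ι] [DecidableEq ι]

theorem conjTranspose_mul_single_mul_apply (U : Matrix A A ℂ) (a a' x : A) :
    (Uᴴ * Matrix.single a a' (1 : ℂ) * U : Matrix A A ℂ) x x = star (U a x) * U a' x := by
  simp only [Matrix.mul_apply, single_apply, conjTranspose_apply, mul_ite, mul_one, mul_zero,
    ite_and, Finset.sum_ite_eq, Finset.mem_univ, if_true, ite_mul, zero_mul]

/-- A classical channel measures in the basis `U` and prepares `ofEigen V (W x)`. -/
theorem classical_apply {Φ : Matrix A A ℂ →ₗ[ℂ] Matrix B B ℂ} {U : Matrix A A ℂ}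
    {V : Matrix B B ℂ} {W : A → B → ℝ}
    (h : ∀ ρ : Matrix A A ℂ, Φ ρ = V * diagonal (fun y => ∑ x, (W x y : ℂ) * (Uᴴ * ρ * U) x x) * Vᴴ)
    (ρ : Matrix A A ℂ) : Φ ρ = ∑ x, (Uᴴ * ρ * U) x x • ofEigen V (W x) := by
  rw [h]
  ext b b'
  rw [Matrix.mul_apply]
  simp only [mul_diagonal, conjTranspose_apply, Matrix.sum_apply, Matrix.smul_apply, smul_eq_mul,
    ofEigen_apply, Finset.mul_sum, Finset.sum_mul]
  rw [Finset.sum_comm]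
  exact Finset.sum_congr rfl fun x _ => Finset.sum_congr rfl fun y _ => by ring

theorem classical_single_apply {Φ : Matrix A A ℂ →ₗ[ℂ] Matrix B B ℂ} {U : Matrix A A ℂ}
    {D : A → Matrix B B ℂ} (h : ∀ ρ : Matrix A A ℂ, Φ ρ = ∑ x, (Uᴴ * ρ * U) x x • D x)
    (a a' : A) (b b' : B) :
    Φ (Matrix.single a a' 1) b b' = ∑ x, star (U a x) * U a' x * D x b b' := by
  rw [h]
  simp only [Matrix.sum_apply, Matrix.smul_apply, conjTranspose_mul_single_mul_apply, smul_eq_mul]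

theorem classical_basis_state {Φ : Matrix A A ℂ →ₗ[ℂ] Matrix B B ℂ} {U : Matrix A A ℂ}
    (hU : U ∈ unitaryGroup A ℂ) {D : A → Matrix B B ℂ}
    (h : ∀ ρ : Matrix A A ℂ, Φ ρ = ∑ x, (Uᴴ * ρ * U) x x • D x) (x : A) :
    IsState (ofEigen U (Pi.single x 1)) ∧ Φ (ofEigen U (Pi.single x 1)) = D x := by
  have hU1 : Uᴴ * U = 1 := (mem_unitaryGroup_iff').1 hU
  constructor
  · refine isState_ofEigen hU (fun i => ?_) (by simp)
    by_cases hi : i = x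
    · subst hi; simp
    · simp [hi]
  · rw [h, ofEigen, show ∀ a b c : Matrix A A ℂ, a * (b * c * a) * b = (a * b) * (c * (a * b)) from
      fun a b c => by simp only [Matrix.mul_assoc], hU1, Matrix.one_mul, Matrix.mul_one,
      Finset.sum_eq_single x]
    · simp
    · intro y _ hy
      simp [hy]
    · simp

/-- The distribution of the outcomes when a state is measured in an orthonormal basis. -/
theorem measurement_distribution {X : Matrix A A ℂ} (hX : IsState X) {U : Matrix A A ℂ}
    (hU : U ∈ unitaryGroup A ℂ) :
    (∀ x, 0 ≤ ((Uᴴ * X * U) x x).re) ∧ (∀ x, (((Uᴴ * X * U) x x).re : ℂ) = (Uᴴ * X * U) x x) ∧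
      ∑ x, ((Uᴴ * X * U) x x).re = 1 := by
  have hU1 : U * Uᴴ = 1 := (mem_unitaryGroup_iff).1 hU
  have h := fun x => Complex.nonneg_iff.1 ((hX.1.conjTranspose_mul_mul_same U).diag_nonneg (i := x))
  refine ⟨fun x => (h x).1, fun x => Complex.ext rfl (by rw [Complex.ofReal_im, (h x).2]), ?_⟩
  rw [← Complex.re_sum]
  have : (Uᴴ * X * U).trace = 1 := by
    rw [trace_mul_comm, ← Matrix.mul_assoc, hU1, Matrix.one_mul, hX.2]
  rw [show ∑ x, (Uᴴ * X * U) x x = 1 from this, Complex.one_re]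

theorem prodMap_classical {Φ : Matrix A A ℂ →ₗ[ℂ] Matrix B B ℂ} {U : Matrix A A ℂ}
    {D : A → Matrix B B ℂ} (h : ∀ ρ : Matrix A A ℂ, Φ ρ = ∑ x, (Uᴴ * ρ * U) x x • D x)
    (X : Matrix (ι → A) (ι → A) ℂ) :
    prodMap (fun _ : ι => Φ) X = ∑ x : ι → A,
      ((prodMatrix fun _ => U)ᴴ * X * prodMatrix fun _ => U : Matrix (ι → A) (ι → A) ℂ) x x •
        prodMatrix fun k => D (x k) := by
  ext b b'
  simp only [prodMap_apply, classical_single_apply h, prod_sum_eq, Matrix.sum_apply,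
    Matrix.smul_apply, smul_eq_mul, Matrix.mul_apply, conjTranspose_apply, prodMatrix_apply,
    Finset.prod_mul_distrib, star_prod, Finset.mul_sum, Finset.sum_mul]
  rw [Finset.sum_congr rfl fun a _ => Finset.sum_comm, Finset.sum_comm]
  refine Finset.sum_congr rfl fun x _ => ?_
  rw [Finset.sum_comm]
  exact Finset.sum_congr rfl fun a' _ => Finset.sum_congr rfl fun a _ => by ring

theorem sum_smul_ofEigen {κ : Type*} [Fintype κ] (V : Matrix B B ℂ) (p : κ → ℝ) (d : κ → B → ℝ) :
    ∑ i, (p i : ℂ) • ofEigen V (d i) = ofEigen V fun y => ∑ i, p i * d i y := by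
  ext b b'
  simp only [Matrix.sum_apply, Matrix.smul_apply, ofEigen_apply, smul_eq_mul, Finset.mul_sum]
  rw [Finset.sum_comm]
  refine Finset.sum_congr rfl fun y _ => ?_
  push_cast
  rw [Finset.sum_mul]
  exact Finset.sum_congr rfl fun i _ => by ring

/-- Additivity of the capacity of a classical channel. -/
theorem IsClassical.oneShotCapacity_tensorPower_le [Nonempty A]
    {Φ : Matrix A A ℂ →ₗ[ℂ] Matrix B B ℂ} (hΦ : PreservesStates Φ) (hcl : IsClassical Φ) (n : ℕ) :
    oneShotCapacity (tensorPower Φ n) ≤ n * oneShotCapacity Φ := by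
  obtain ⟨U, hU, V, hV, W, hW, hW1, h⟩ := hcl
  have hD := classical_apply h
  have hW' : ∀ x, IsState (ofEigen V (W x)) := fun x => isState_ofEigen hV (hW x) (hW1 x)
  have hUn := prodMatrix_mem_unitaryGroup fun _ : Fin n => hU
  have hVn := prodMatrix_mem_unitaryGroup fun _ : Fin n => hV
  set 𝒰 := prodMatrix fun _ : Fin n => U
  let q : Matrix (Fin n → A) (Fin n → A) ℂ → (Fin n → A) → ℝ := fun X x => ((𝒰ᴴ * X * 𝒰) x x).re
  have hout : ∀ X, IsState X → tensorPower Φ n X =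
      ∑ x, (q X x : ℂ) • prodMatrix fun k => ofEigen V (W (x k)) := by
    intro X hX
    rw [tensorPower_eq_prodMap, prodMap_classical hD]
    exact Finset.sum_congr rfl fun x _ => by rw [(measurement_distribution hX hUn).2.1 x]
  -- The output is a mixture over outcomes `x` of product states, so concavity bounds its entropy
  -- below by an expression affine in the input.
  have hlow : ∀ X, IsState X →
      ∑ x, q X x * ∑ k, vonNeumannEntropy (ofEigen V (W (x k))) ≤
        vonNeumannEntropy (tensorPower Φ n X) := by
    intro X hX
    have hm := measurement_distribution hX hUn
    rw [hout X hX]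
    refine le_trans (le_of_eq ?_) (sum_mul_vonNeumannEntropy_le hm.1 hm.2.2
      fun x => (isState_prodMatrix fun k => hW' (x k)).1)
    simp only [vonNeumannEntropy_prodMatrix fun k => hW' _]
    rfl
  -- All outputs are diagonal in the product basis of `V`, so Shannon subadditivity applies.
  have hupp : ∀ X, IsState X → vonNeumannEntropy (tensorPower Φ n X) ≤
      ∑ k, vonNeumannEntropy (∑ x, (q X x : ℂ) • ofEigen V (W (x k))) := by
    intro X hX
    obtain ⟨hm0, -, hm1⟩ := measurement_distribution hX hUn
    change ∀ x, 0 ≤ q X x at hm0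
    change ∑ x, q X x = 1 at hm1
    simp only [hout X hX, prodMatrix_ofEigen, sum_smul_ofEigen, vonNeumannEntropy_ofEigen hVn,
      vonNeumannEntropy_ofEigen hV]
    refine sum_negMulLog_le_sum_marginals
      (fun y => Finset.sum_nonneg fun x _ =>
        mul_nonneg (hm0 x) (Finset.prod_nonneg fun k _ => hW _ _)) ?_
      (fun k b => Finset.sum_nonneg fun x _ => mul_nonneg (hm0 x) (hW _ _)) ?_
    · rw [Finset.sum_comm]
      simp only [← Finset.mul_sum]
      simp only [← prod_sum_eq, hW1, Finset.prod_const_one, mul_one,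
        hm1]
    · intro k f
      simp only [Finset.sum_mul]
      rw [Finset.sum_comm, Finset.sum_comm (s := Finset.univ (α := B))]
      refine Finset.sum_congr rfl fun x _ => ?_
      simp only [mul_assoc, ← Finset.mul_sum]
      rw [sum_prod_mul_apply (d := fun k => W (x k)) (fun k => hW1 _) k f]
  refine oneShotCapacity_le fun 𝓔 => ?_
  have hX := isState_sum 𝓔.p_nonneg 𝓔.p_sum 𝓔.isState
  set X := ∑ i, (𝓔.p i : ℂ) • 𝓔.ρ i with hXdef
  have hq : ∀ x, q X x = ∑ i, 𝓔.p i * q (𝓔.ρ i) x := by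
    intro x
    simp only [q, hXdef, Matrix.mul_sum, Matrix.sum_mul, Matrix.sum_apply, Complex.re_sum,
      Matrix.mul_smul, Matrix.smul_mul]
    exact Finset.sum_congr rfl fun i _ => Complex.re_ofReal_mul _ _
  have h1 : ∑ x, q X x * ∑ k, vonNeumannEntropy (ofEigen V (W (x k))) ≤
      ∑ i, 𝓔.p i * vonNeumannEntropy (tensorPower Φ n (𝓔.ρ i)) := by
    simp only [hq, Finset.sum_mul]
    rw [Finset.sum_comm]
    refine Finset.sum_le_sum fun i _ => ?_
    simp only [mul_assoc, ← Finset.mul_sum]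
    exact mul_le_mul_of_nonneg_left (hlow _ (𝓔.isState i)) (𝓔.p_nonneg i)
  -- For each position `k`, weight `q X x` on the basis state `x k` defines a single-use ensemble,
  -- indexed by whole strings so that no marginal need be formed.
  have h2 : ∀ k, vonNeumannEntropy (∑ x, (q X x : ℂ) • ofEigen V (W (x k))) -
      ∑ x, q X x * vonNeumannEntropy (ofEigen V (W (x k))) ≤ oneShotCapacity Φ := by
    intro k
    have hm := measurement_distribution hX hUn
    have h3 := holevo_le_oneShotCapacity hΦ hm.1 hm.2.2
      fun x : Fin n → A => (classical_basis_state hU hD (x k)).1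
    simp only [(classical_basis_state hU hD _).2] at h3
    exact h3
  have h4 : holevoInfo (tensorPower Φ n) 𝓔 = vonNeumannEntropy (tensorPower Φ n X) -
      ∑ i, 𝓔.p i * vonNeumannEntropy (tensorPower Φ n (𝓔.ρ i)) := by
    rw [holevoInfo, hXdef, map_sum]
    simp only [map_smul]
  have h5 : ∑ x, q X x * ∑ k, vonNeumannEntropy (ofEigen V (W (x k))) =
      ∑ k, ∑ x, q X x * vonNeumannEntropy (ofEigen V (W (x k))) := by
    simp only [Finset.mul_sum]
    exact Finset.sum_comm
  have h6 := Finset.sum_le_sum fun (k : Fin n) (_ : k ∈ Finset.univ) => h2 k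
  rw [Finset.sum_sub_distrib, Finset.sum_const, Finset.card_univ, Fintype.card_fin,
    nsmul_eq_mul] at h6
  have h7 := hupp X hX
  linarith

theorem sum_reorder {κ₁ κ₂ κ₃ R : Type*} [Fintype κ₁] [Fintype κ₂] [Fintype κ₃]
    [AddCommMonoid R] (F : κ₁ → κ₂ → κ₁ → κ₂ → κ₃ → R) :
    ∑ a, ∑ c, ∑ a', ∑ c', ∑ x, F a c a' c' x = ∑ x, ∑ c, ∑ c', ∑ a, ∑ a', F a c a' c' x := by
  have h1 : ∀ a c, ∑ a', ∑ c', ∑ x, F a c a' c' x = ∑ x, ∑ c', ∑ a', F a c a' c' x := by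
    intro a c
    rw [Finset.sum_comm, Finset.sum_congr rfl fun c' _ => Finset.sum_comm, Finset.sum_comm]
  simp only [h1]
  rw [Finset.sum_congr rfl fun a _ => Finset.sum_comm, Finset.sum_comm]
  refine Finset.sum_congr rfl fun x _ => ?_
  rw [Finset.sum_comm]
  exact Finset.sum_congr rfl fun c _ => Finset.sum_comm

/-- A product of copies of a classical channel `Φ` and of other channels, after the measurement of
the inputs of the copies of `Φ`. -/
theorem prodMap_mixed {Φ : Matrix A A ℂ →ₗ[ℂ] Matrix B B ℂ} {U : Matrix A A ℂ}
    {D : A → Matrix B B ℂ} (h : ∀ ρ : Matrix A A ℂ, Φ ρ = ∑ x, (Uᴴ * ρ * U) x x • D x)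
    (p : ι → Prop) [DecidablePred p] {Ψ : ι → Matrix A A ℂ →ₗ[ℂ] Matrix B B ℂ}
    (hΨ : ∀ k, p k → Ψ k = Φ) (X : Matrix (ι → A) (ι → A) ℂ) :
    (prodMap Ψ X).submatrix (Equiv.piEquivPiSubtypeProd p fun _ => B).symm
      (Equiv.piEquivPiSubtypeProd p fun _ => B).symm =
    ∑ x : {k // p k} → A, kroneckerMap (· * ·) (prodMatrix fun k => D (x k))
      (prodMap (fun k : {k // ¬p k} => Ψ k)
        (((kroneckerMap (· * ·) (prodMatrix fun _ : {k // p k} => U)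
            (1 : Matrix ({k // ¬p k} → A) _ ℂ))ᴴ *
          X.submatrix (Equiv.piEquivPiSubtypeProd p fun _ => A).symm
            (Equiv.piEquivPiSubtypeProd p fun _ => A).symm *
          kroneckerMap (· * ·) (prodMatrix fun _ : {k // p k} => U)
            (1 : Matrix ({k // ¬p k} → A) _ ℂ)).submatrix (Prod.mk x) (Prod.mk x))) := by
  set f := (Equiv.piEquivPiSubtypeProd p fun _ => A).symm with hf
  have hτ : ∀ x : {k // p k} → A, ∀ c c' : {k // ¬p k} → A,
      ((kroneckerMap (· * ·) (prodMatrix fun _ : {k // p k} => U)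
            (1 : Matrix ({k // ¬p k} → A) _ ℂ))ᴴ * X.submatrix f f *
          kroneckerMap (· * ·) (prodMatrix fun _ : {k // p k} => U)
            (1 : Matrix ({k // ¬p k} → A) _ ℂ)) (x, c) (x, c') =
      ∑ a, ∑ a', X (f (a, c)) (f (a', c')) *
        ((∏ k, star (U (a k) (x k))) * ∏ k, U (a' k) (x k)) := by
    intro x c c'
    simp only [Matrix.mul_apply, conjTranspose_apply, kroneckerMap_apply, Fintype.sum_prod_type,
      one_apply, submatrix_apply, mul_ite, mul_one, mul_zero, Finset.sum_ite_eq', Finset.mem_univ,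
      if_true, prodMatrix_apply, apply_ite star, star_zero, ite_mul, zero_mul, star_prod,
      Finset.sum_mul]
    rw [Finset.sum_comm]
    exact Finset.sum_congr rfl fun a _ => Finset.sum_congr rfl fun a' _ => by ring
  have hprod : ∀ (a a' : {k // p k} → A) (c c' : {k // ¬p k} → A) (b b' : {k // p k} → B)
      (d d' : {k // ¬p k} → B),
      ∏ k, Ψ k (Matrix.single (f (a, c) k) (f (a', c') k) 1)
        ((Equiv.piEquivPiSubtypeProd p fun _ => B).symm (b, d) k)
        ((Equiv.piEquivPiSubtypeProd p fun _ => B).symm (b', d') k) =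
      (∏ k, Φ (Matrix.single (a k) (a' k) 1) (b k) (b' k)) *
        ∏ k : {k // ¬p k}, Ψ k (Matrix.single (c k) (c' k) 1) (d k) (d' k) := by
    intro a a' c c' b b' d d'
    rw [← Fintype.prod_subtype_mul_prod_subtype p]
    congr 1
    · refine Finset.prod_congr rfl fun k _ => ?_
      simp [hf, Equiv.piEquivPiSubtypeProd_symm_apply, k.2, hΨ k k.2]
    · refine Finset.prod_congr rfl fun k _ => ?_
      simp [hf, Equiv.piEquivPiSubtypeProd_symm_apply, k.2]
  ext ⟨b, d⟩ ⟨b', d'⟩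
  simp only [submatrix_apply, prodMap_apply, Matrix.sum_apply, kroneckerMap_apply, hτ]
  rw [← Equiv.sum_comp f, Fintype.sum_prod_type]
  have hinner : ∀ a : ι → A, ∑ a', X a a' * ∏ k, Ψ k (Matrix.single (a k) (a' k) 1)
        ((Equiv.piEquivPiSubtypeProd p fun _ => B).symm (b, d) k)
        ((Equiv.piEquivPiSubtypeProd p fun _ => B).symm (b', d') k) =
      ∑ a₁, ∑ c', X a (f (a₁, c')) * ∏ k, Ψ k (Matrix.single (a k) (f (a₁, c') k) 1)
        ((Equiv.piEquivPiSubtypeProd p fun _ => B).symm (b, d) k)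
        ((Equiv.piEquivPiSubtypeProd p fun _ => B).symm (b', d') k) := by
    intro a
    rw [← Equiv.sum_comp f, Fintype.sum_prod_type]
  simp only [hinner, hprod, classical_single_apply h, prod_sum_eq, Finset.prod_mul_distrib,
    Finset.mul_sum, Finset.sum_mul, prodMatrix_apply]
  rw [sum_reorder]
  refine Finset.sum_congr rfl fun x _ => Finset.sum_congr rfl fun c _ =>
    Finset.sum_congr rfl fun c' _ => Finset.sum_congr rfl fun a _ =>
    Finset.sum_congr rfl fun a' _ => ?_
  ring

end Classical

/-! ### Entropy and capacity bounds for the conditional channel -/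

section Mixed

variable {A B ι : Type*} [Fintype A] [DecidableEq A] [Fintype B] [DecidableEq B]
  [Fintype ι] [DecidableEq ι]

/-- The entropy of the average is at most `log|B|`, and each subtracted entropy is at least `s`. -/
theorem oneShotCapacity_le_log_sub [Nonempty A] {Φ : Matrix A A ℂ →ₗ[ℂ] Matrix B B ℂ}
    (hΦ : PreservesStates Φ) {s : ℝ} (h : ∀ ρ, IsState ρ → s ≤ vonNeumannEntropy (Φ ρ)) :
    oneShotCapacity Φ ≤ Real.log (Fintype.card B) - s := by
  refine oneShotCapacity_le fun 𝓔 => ?_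
  have h1 := (isState_sum 𝓔.p_nonneg 𝓔.p_sum fun i => hΦ _ (𝓔.isState i)).vonNeumannEntropy_le
  have h2 : s ≤ ∑ i, 𝓔.p i * vonNeumannEntropy (Φ (𝓔.ρ i)) := by
    calc s = ∑ i, 𝓔.p i * s := by rw [← Finset.sum_mul, 𝓔.p_sum, one_mul]
      _ ≤ _ := Finset.sum_le_sum fun i _ =>
        mul_le_mul_of_nonneg_left (h _ (𝓔.isState i)) (𝓔.p_nonneg i)
  rw [holevoInfo]
  linarith

theorem prodMap_const_entropy {Φ : Matrix A A ℂ →ₗ[ℂ] Matrix B B ℂ}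
    (hΦ : PreservesStates (tensorPower Φ (Fintype.card ι))) {s : ℝ}
    (hs : ∀ ρ, IsState ρ → s ≤ vonNeumannEntropy (tensorPower Φ (Fintype.card ι) ρ))
    {ρ : Matrix (ι → A) (ι → A) ℂ} (hρ : IsState ρ) :
    IsState (prodMap (fun _ : ι => Φ) ρ) ∧ s ≤ vonNeumannEntropy (prodMap (fun _ : ι => Φ) ρ) := by
  let e := (Fintype.equivFin ι).symm
  have h1 := prodMap_submatrix (fun _ : ι => Φ) e ρ
  have h2 := hρ.submatrix (e.arrowCongr (Equiv.refl A))
  have h3 : prodMap (fun _ : ι => Φ) ρ = (tensorPower Φ (Fintype.card ι)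
      (ρ.submatrix (e.arrowCongr (Equiv.refl A)) (e.arrowCongr (Equiv.refl A)))).submatrix
        (e.arrowCongr (Equiv.refl B)).symm (e.arrowCongr (Equiv.refl B)).symm := by
    rw [tensorPower_eq_prodMap, ← h1, submatrix_submatrix, Equiv.self_comp_symm, submatrix_id_id]
  rw [h3, vonNeumannEntropy_submatrix (hΦ _ h2).1.1]
  exact ⟨(hΦ _ h2).submatrix _, hs _ h2⟩

/-- The linear map `Y ↦ M ⊗ Y`. -/
def kroneckerLeft {C : Type*} (M : Matrix C C ℂ) :
    Matrix B B ℂ →ₗ[ℂ] Matrix (C × B) (C × B) ℂ where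
  toFun Y := kroneckerMap (· * ·) M Y
  map_add' Y Z := by
    ext i j
    simp [mul_add]
  map_smul' c Y := by
    ext i j
    simp [mul_left_comm]

/-- Output entropy of a product of copies of a classical channel and copies of another one. -/
theorem le_vonNeumannEntropy_prodMap_mixed [Nonempty A] {N₀ N₁ : Matrix A A ℂ →ₗ[ℂ] Matrix B B ℂ}
    (hN₀ : PreservesStates N₀) (hN₁ : ∀ n, PreservesStates (tensorPower N₁ n))
    (hcl : IsClassical N₀) {s : ℕ → ℝ}
    (hs : ∀ n ρ, IsState ρ → s n ≤ vonNeumannEntropy (tensorPower N₁ n ρ))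
    (p : ι → Prop) [DecidablePred p] {Ψ : ι → Matrix A A ℂ →ₗ[ℂ] Matrix B B ℂ}
    (h0 : ∀ k, p k → Ψ k = N₀) (h1 : ∀ k, ¬p k → Ψ k = N₁)
    (hΨ : PreservesStates (prodMap Ψ)) {X : Matrix (ι → A) (ι → A) ℂ} (hX : IsState X) :
    Fintype.card {k // p k} * minOutputEntropy N₀ + s (Fintype.card {k // ¬p k}) ≤
      vonNeumannEntropy (prodMap Ψ X) := by
  obtain ⟨U, hU, V, hV, W, hW, hW1, h⟩ := hcl
  have hD := classical_apply h
  have hW' : ∀ x, IsState (ofEigen V (W x)) := fun x => isState_ofEigen hV (hW x) (hW1 x)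
  have hWs : ∀ x, minOutputEntropy N₀ ≤ vonNeumannEntropy (ofEigen V (W x)) := by
    intro x
    have := classical_basis_state hU hD x
    rw [← this.2]
    exact minOutputEntropy_le hN₀ this.1
  have hΨ1 : (fun k : {k // ¬p k} => Ψ k) = fun _ => N₁ := funext fun k => h1 k k.2
  rw [← vonNeumannEntropy_submatrix (hΨ _ hX).1.1 (Equiv.piEquivPiSubtypeProd p fun _ => B).symm,
    prodMap_mixed hD p h0, hΨ1]
  -- `T` rotates the inputs of `N₀` to the measurement basis. The block of `Tᴴ * X' * T` at `x` is
  -- the unnormalized state of the other inputs given outcome `x`.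
  set T := kroneckerMap (· * ·) (prodMatrix fun _ : {k // p k} => U)
    (1 : Matrix ({k // ¬p k} → A) ({k // ¬p k} → A) ℂ) with hT
  have hTu : T ∈ unitaryGroup _ ℂ :=
    kronecker_mem_unitaryGroup (prodMatrix_mem_unitaryGroup fun _ => hU) (one_mem _)
  have hTT : T * Tᴴ = 1 := mem_unitaryGroup_iff.1 hTu
  have hX' := hX.submatrix (Equiv.piEquivPiSubtypeProd p fun _ => A).symm
  set X' := X.submatrix (Equiv.piEquivPiSubtypeProd p fun _ => A).symm
    (Equiv.piEquivPiSubtypeProd p fun _ => A).symm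
  have hY : (Tᴴ * X' * T).PosSemidef := hX'.1.conjTranspose_mul_mul_same T
  have hYtr : (Tᴴ * X' * T).trace = 1 := by
    rw [trace_mul_comm, ← Matrix.mul_assoc, hTT, Matrix.one_mul, hX'.2]
  set D := fun x : {k // p k} → A => prodMatrix fun k => ofEigen V (W (x k)) with hDdef
  have hDs : ∀ x, IsState (D x) := fun x => isState_prodMatrix fun k => hW' (x k)
  have hDe : ∀ x, Fintype.card {k // p k} * minOutputEntropy N₀ ≤ vonNeumannEntropy (D x) := by
    intro x
    rw [hDdef, vonNeumannEntropy_prodMatrix fun k => hW' (x k), ← nsmul_eq_mul]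
    exact Finset.card_nsmul_le_sum _ _ _ fun k _ => hWs _
  have hN := fun (ρ : Matrix ({k // ¬p k} → A) ({k // ¬p k} → A) ℂ) (hρ : IsState ρ) =>
    prodMap_const_entropy (hN₁ _) (hs _) hρ
  let Φ : ({k // p k} → A) → Matrix ({k // ¬p k} → A) ({k // ¬p k} → A) ℂ →ₗ[ℂ]
      Matrix (({k // p k} → B) × ({k // ¬p k} → B)) (({k // p k} → B) × ({k // ¬p k} → B)) ℂ :=
    fun x => kroneckerLeft (D x) ∘ₗ prodMap fun _ : {k // ¬p k} => N₁
  have hΦ : ∀ x Y, Φ x Y = kroneckerMap (· * ·) (D x) (prodMap (fun _ => N₁) Y) :=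
    fun _ _ => rfl
  change _ ≤ vonNeumannEntropy
    (∑ x, Φ x ((Tᴴ * X' * T).submatrix (Prod.mk x) (Prod.mk x)))
  refine le_vonNeumannEntropy_sum (fun x => hY.submatrix _) ?_ (fun x ρ hρ => ?_) fun x ρ hρ => ?_
  · rw [← hYtr]
    simp only [Matrix.trace, Fintype.sum_prod_type]
    rfl
  · rw [hΦ]
    exact (hDs x).kronecker (hN ρ hρ).1
  · rw [hΦ, vonNeumannEntropy_kronecker (hDs x) (hN ρ hρ).1]
    exact add_le_add (hDe x) (hN ρ hρ).2

/-- Each branch of a conditional channel can be simulated by fixing the control. -/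
theorem oneShotCapacity_tensorPower_le_conditionalChannel [Nonempty A]
    {N : Fin 2 → Matrix A A ℂ →ₗ[ℂ] Matrix B B ℂ} (hN : ∀ i, IsChannel (N i)) (i : Fin 2) (n : ℕ) :
    oneShotCapacity (tensorPower (N i) n) ≤
      oneShotCapacity (tensorPower (conditionalChannel (N 0) (N 1)) n) := by
  refine oneShotCapacity_le_of_simulates (preservesStates_prodMap fun _ => hN i)
    (preservesStates_tensorPower_conditionalChannel hN n) (Equiv.refl _) fun ρ hρ => ?_
  -- The isometry that adjoins controls all equal to `i`.
  let G : Matrix (Fin n → Fin 2 × A) (Fin n → A) ℂ :=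
    Matrix.of fun a c => if a = fun k => (i, c k) then 1 else 0
  have hinj : ∀ c c' : Fin n → A,
      ((fun k => (i, c k)) = fun k => (i, c' k)) ↔ c = c' := by
    intro c c'
    simp [funext_iff]
  have hG : Gᴴ * G = 1 := by
    ext c c'
    simp [Matrix.mul_apply, G, one_apply, hinj, eq_comm]
  have hblock : ∀ m : Fin n → Fin 2, (G * ρ * Gᴴ).submatrix
      (fun (a : Fin n → A) k => (m k, a k)) (fun a k => (m k, a k)) =
      if m = fun _ => i then ρ else 0 := by
    intro m
    have hg : ∀ a c : Fin n → A, G (fun k => (m k, a k)) c =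
        if m = (fun _ => i) then (if a = c then 1 else 0) else 0 := by
      intro a c
      simp only [G, of_apply, funext_iff, Prod.mk.injEq, forall_and, ite_and]
    ext a a'
    simp only [submatrix_apply, Matrix.mul_apply, conjTranspose_apply, hg]
    split_ifs
    · simp
    · simp
  refine ⟨G * ρ * Gᴴ, ⟨hρ.1.mul_mul_conjTranspose_same G, ?_⟩, ?_⟩
  · rw [trace_mul_comm, ← Matrix.mul_assoc, hG, Matrix.one_mul, hρ.2]
  · rw [tensorPower_conditionalChannel, Finset.sum_eq_single fun _ => i]
    · rw [hblock, if_pos rfl]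
      rfl
    · intro m _ hm
      rw [hblock, if_neg hm, map_zero]
    · simp

/-- If the branches have capacity at most `K` per use, so has the conditional channel. -/
theorem oneShotCapacity_tensorPower_conditionalChannel_le [Nonempty A]
    {N : Fin 2 → Matrix A A ℂ →ₗ[ℂ] Matrix B B ℂ} (hN : ∀ i, IsChannel (N i))
    (hN₀ : PreservesStates (N 0)) (hcl : IsClassical (N 0))
    (hs : ∀ n ρ, IsState ρ → n * Real.log (Fintype.card B) - oneShotCapacity (tensorPower (N 1) n) ≤
      vonNeumannEntropy (tensorPower (N 1) n ρ)) {K : ℝ} {n : ℕ}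
    (hK0 : Real.log (Fintype.card B) - minOutputEntropy (N 0) ≤ K)
    (hK1 : ∀ l ≤ n, oneShotCapacity (tensorPower (N 1) l) ≤ l * K) :
    oneShotCapacity (tensorPower (conditionalChannel (N 0) (N 1)) n) ≤ n * K := by
  have hlow : ∀ ρ, IsState ρ → n * (Real.log (Fintype.card B) - K) ≤
      vonNeumannEntropy (tensorPower (conditionalChannel (N 0) (N 1)) n ρ) := by
    intro ρ hρ
    rw [tensorPower_conditionalChannel]
    refine le_vonNeumannEntropy_sum (fun m => hρ.1.submatrix _)
      ((trace_sum_blocks n ρ).trans hρ.2) (fun m => preservesStates_prodMap fun k => hN (m k))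
      fun m σ hσ => ?_
    have h1 := le_vonNeumannEntropy_prodMap_mixed hN₀
      (fun n => preservesStates_prodMap fun _ => hN 1) hcl hs (fun k => m k = 0)
      (Ψ := fun k => N (m k)) (fun k hk => by rw [hk])
      (fun k hk => by rw [Fin.eq_one_of_ne_zero _ hk])
      (preservesStates_prodMap fun k => hN (m k)) hσ
    refine le_trans ?_ h1
    have hcard : Fintype.card {k // m k = 0} + Fintype.card {k // ¬m k = 0} = n := by
      have := Fintype.card_subtype_compl fun k => m k = 0
      have h2 := Fintype.card_subtype_le fun k => m k = 0
      rw [Fintype.card_fin] at this h2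
      omega
    have h3 := hK1 (Fintype.card {k // ¬m k = 0}) (by omega)
    have h4 : (Fintype.card {k // m k = 0} : ℝ) + Fintype.card {k // ¬m k = 0} = n := by
      exact_mod_cast hcard
    -- With `k` uses of `N 0` and `l` of `N 1`, the bound in `h1` is at least `k (log|B| - K) + (l
    -- log|B| - l K)`.
    have h5 := mul_le_mul_of_nonneg_left hK0 (Nat.cast_nonneg (α := ℝ) (Fintype.card {k // m k = 0}))
    rw [← h4]
    linarith
  have h := oneShotCapacity_le_log_sub (preservesStates_tensorPower_conditionalChannel hN n) hlow
  refine h.trans (le_of_eq ?_)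
  rw [Fintype.card_fun, Fintype.card_fin, Nat.cast_pow, Real.log_pow]
  ring

end Mixed

end QuantumShannon

open QuantumShannon
theorem lemma2 {A B : Type*} [Fintype A] [DecidableEq A] [Nonempty A] [Fintype B] [DecidableEq B]
    (N₀ N₁ : Matrix A A ℂ →ₗ[ℂ] Matrix B B ℂ)
    (hN₀ : IsChannel N₀) (hN₁ : IsChannel N₁) (hcl : IsClassical N₀)
    (h01 : classicalCapacity N₀ = Real.log (Fintype.card B) - minOutputEntropy N₀)
    (h12 : ∀ n : ℕ, 1 ≤ n → ∀ P : ℝ, 0 ≤ P →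
      assistedNShotCapacity N₁ n P = Real.log (Fintype.card B) - minEntropyGap N₁ n P) :
    (oneShotCapacity (conditionalChannel N₀ N₁) =
        max (classicalCapacity N₀) (oneShotCapacity N₁) ∧
      classicalCapacity (conditionalChannel N₀ N₁) =
        max (classicalCapacity N₀) (classicalCapacity N₁)) ∧
    -- the limits that define the three regularized capacities exist
    (Tendsto (nShotCapacity (conditionalChannel N₀ N₁)) atTop
        (𝓝 (classicalCapacity (conditionalChannel N₀ N₁))) ∧
      Tendsto (nShotCapacity N₀) atTop (𝓝 (classicalCapacity N₀)) ∧
      Tendsto (nShotCapacity N₁) atTop (𝓝 (classicalCapacity N₁))) := by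
  -- A family over `Fin 2` lets a control string select the channels as `N (m k)`.
  obtain ⟨N, rfl, rfl⟩ : ∃ N : Fin 2 → Matrix A A ℂ →ₗ[ℂ] Matrix B B ℂ, N 0 = N₀ ∧ N 1 = N₁ :=
    ⟨![N₀, N₁], rfl, rfl⟩
  have hN : ∀ i, IsChannel (N i) := Fin.forall_fin_two.2 ⟨hN₀, hN₁⟩
  have hp₀ : ∀ n, PreservesStates (tensorPower (N 0) n) := fun n => preservesStates_prodMap fun _ => hN₀
  have hp₁ : ∀ n, PreservesStates (tensorPower (N 1) n) := fun n => preservesStates_prodMap fun _ => hN₁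
  have hp : ∀ n, PreservesStates (tensorPower (conditionalChannel (N 0) (N 1)) n) :=
    preservesStates_tensorPower_conditionalChannel hN
  have hN₀' : PreservesStates (N 0) := preservesStates_of_tensorPower_one (hp₀ 1)
  have ht₀ := tendsto_nShotCapacity hp₀
  have ht₁ := tendsto_nShotCapacity hp₁
  have ht := tendsto_nShotCapacity hp
  have hs := fun n ρ => mul_log_sub_oneShotCapacity_le (ρ := ρ) hp₁
    (fun n hn => h12 n hn 0 le_rfl) n
  have hupp : ∀ (K : ℝ) (n : ℕ), classicalCapacity (N 0) ≤ K →
      (∀ l ≤ n, oneShotCapacity (tensorPower (N 1) l) ≤ l * K) →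
      oneShotCapacity (tensorPower (conditionalChannel (N 0) (N 1)) n) ≤ n * K := fun K n hK hl =>
    oneShotCapacity_tensorPower_conditionalChannel_le hN hN₀' hcl hs (h01 ▸ hK) hl
  have hlow := oneShotCapacity_tensorPower_le_conditionalChannel hN
  have hlow₀ : ∀ n, oneShotCapacity (tensorPower (N 0) n) ≤
    oneShotCapacity (tensorPower (conditionalChannel (N 0) (N 1)) n) := hlow 0
  have hlow₁ : ∀ n, oneShotCapacity (tensorPower (N 1) n) ≤
    oneShotCapacity (tensorPower (conditionalChannel (N 0) (N 1)) n) := hlow 1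
  -- One use with the control at `0` achieves only the one-shot capacity, so additivity is needed to
  -- reach the regularized one.
  have hadd : classicalCapacity (N 0) ≤ oneShotCapacity (N 0) := by
    refine le_of_tendsto ht₀.1 ((eventually_gt_atTop 0).mono fun n hn => ?_)
    rw [nShotCapacity, div_le_iff₀ (by exact_mod_cast hn), mul_comm]
    exact hcl.oneShotCapacity_tensorPower_le hN₀' n
  have hz : oneShotCapacity (tensorPower (N 1) 0) ≤ 0 := by simpa using ht₁.2 0
  refine ⟨⟨le_antisymm ?_ (max_le ?_ ?_), le_antisymm ?_ (max_le ?_ ?_)⟩, ht.1, ht₀.1, ht₁.1⟩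
  · have h := hupp (max (classicalCapacity (N 0)) (oneShotCapacity (N 1))) 1 (le_max_left _ _) ?_
    · rwa [oneShotCapacity_tensorPower_one (hp 1), Nat.cast_one, one_mul] at h
    · intro l hl
      interval_cases l
      · simpa using hz
      · rw [oneShotCapacity_tensorPower_one (hp₁ 1), Nat.cast_one, one_mul]
        exact le_max_right _ _
  · have h := hlow₀ 1
    rw [oneShotCapacity_tensorPower_one (hp 1), oneShotCapacity_tensorPower_one (hp₀ 1)] at h
    exact hadd.trans h
  · have h := hlow₁ 1
    rwa [oneShotCapacity_tensorPower_one (hp 1), oneShotCapacity_tensorPower_one (hp₁ 1)] at h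
  · refine le_of_tendsto ht.1 ((eventually_gt_atTop 0).mono fun n hn => ?_)
    rw [nShotCapacity, div_le_iff₀ (by exact_mod_cast hn), mul_comm]
    -- By superadditivity, `l` uses of `N 1` have capacity at most `l` times the regularized one.
    refine hupp _ n (le_max_left _ _) fun l _ => (ht₁.2 l).trans ?_
    exact mul_le_mul_of_nonneg_left (le_max_right _ _) (Nat.cast_nonneg l)
  · exact le_of_tendsto_of_tendsto' ht₀.1 ht.1 fun n =>
      div_le_div_of_nonneg_right (hlow₀ n) (Nat.cast_nonneg n)
  · exact le_of_tendsto_of_tendsto' ht₁.1 ht.1 fun n =>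
      div_le_div_of_nonneg_right (hlow₁ n) (Nat.cast_nonneg n)
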